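/- Let $G$ be a finite connected simple graph with vertices $v_1,\dots,v_N$, and let $G^{\varphi}$ be a complex unit gain graph on $G$: to each oriented edge $e_{ij}$ (from $v_i$ to $v_j$, where $v_iv_j\in E(G)$) is assigned a complex number $\varphi(e_{ij})$ of modulus $1$ with $\varphi(e_{ji})=\varphi(e_{ij})^{-1}$. Let $A(G^{\varphi})$ be the Hermitian matrix with $(i,j)$ entry $\varphi(e_{ij})$ if $v_iv_j\in E(G)$ and $0$ otherwise, and let $n(G^{\varphi})$ be the number of its negative eigenvalues, counted with multiplicity. Let $m(\cdot)$ denote the matching number (the number of edges in a maximum matching) of a graph, let $c(G)=|E(G)|-|V(G)|+\omega(G)$ be the cyclomatic number, where $\omega(G)$ is the number of connected components, and let $O(G)$ be the set of vertices of $G$ that lie on cycles. For a cycle $C=u_1u_2\cdots u_ku_1$ of $G$ put $\varphi(C)=\varphi_{u_1u_2}\varphi_{u_2u_3}\cdots\varphi_{u_{k-1}u_k}\varphi_{u_ku_1}$, where $\varphi_{uv}$ is the gain of the oriented edge from $u$ to $v$; the cycle is of Type D if $k$ is odd and $\mathrm{Re}\left((-1)^{(k-1)/2}\varphi(C)\right)<0$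 (this does not depend on the starting vertex or on the direction). If the cycles of $G$ are pairwise vertex-disjoint, let $T_G$ be the graph obtained from $G$ by contracting each cycle to a single vertex. Then $n(G^{\varphi})=m(G)+c(G)$ if and only if the following three conditions all hold: (a) any two distinct cycles of $G$ have no common vertex; (b) every cycle of $G^{\varphi}$ is of Type D; (c) $m(T_G)=m(G-O(G))$. -/

import Mathlib

/-- A complex unit gain graph on the vertex set `V`: a simple graph together with a map from its
oriented edges to the circle group which takes inverse values on opposite orientations. -/
structure UnitGainGraph (V : Type*) where
  graph : SimpleGraph V
  gain : graph.Dart → Circle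
  gain_symm : ∀ d : graph.Dart, gain d.symm = (gain d)⁻¹

namespace SimpleGraph

/-- A subgraph of `G` which is a cycle (of length at least three). Two cycles are the same
if they are equal as subgraphs, whatever the base point and the direction in which
they are traversed. -/
def IsCycleSubgraph {V : Type*} (G : SimpleGraph V) (C : G.Subgraph) : Prop :=
  ∃ (u : V) (p : G.Walk u u), p.IsCycle ∧ p.toSubgraph = C

/-- Any two distinct cycles of `G` have no common vertex. -/
def DisjointCycles {V : Type*} (G : SimpleGraph V) : Prop :=
  ∀ C₁ C₂ : G.Subgraph, G.IsCycleSubgraph C₁ → G.IsCycleSubgraph C₂ → C₁ ≠ C₂ →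
    Disjoint C₁.verts C₂.verts

/-- The set `O(G)` of the vertices of `G` lying on cycles. -/
def cycleVerts {V : Type*} (G : SimpleGraph V) : Set V :=
  {v | ∃ C : G.Subgraph, G.IsCycleSubgraph C ∧ v ∈ C.verts}

/-- The number of edges of a maximum matching (for a finite vertex set). -/
noncomputable def matchingNumber {V : Type*} (G : SimpleGraph V) : ℕ :=
  sSup {k | ∃ M : G.Subgraph, M.IsMatching ∧ M.edgeSet.ncard = k}

/-- The cyclomatic number `|E(G)| - |V(G)| + ω(G)` (for a finite vertex set). -/
noncomputable def cyclomaticNumber {V : Type*} (G : SimpleGraph V) : ℤ :=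
  (G.edgeSet.ncard : ℤ) - (Nat.card V : ℤ) + (Nat.card G.ConnectedComponent : ℤ)

/-- The equivalence relation generated by identifying two vertices whenever they
lie on a common cycle. If the cycles are pairwise vertex-disjoint, its classes are the vertex
sets of the cycles and the singletons of the vertices outside all cycles. -/
def cycleSetoid {V : Type*} (G : SimpleGraph V) : Setoid V :=
  Relation.EqvGen.setoid fun u v =>
    ∃ C : G.Subgraph, G.IsCycleSubgraph C ∧ u ∈ C.verts ∧ v ∈ C.verts

/-- The graph `T_G` obtained from `G` by contracting each cycle into a vertex: distinct
classes are adjacent if some representatives are adjacent in `G`. -/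
def contractCycles {V : Type*} (G : SimpleGraph V) : SimpleGraph (Quotient G.cycleSetoid) :=
  G.map (Quotient.mk G.cycleSetoid)

end SimpleGraph

namespace UnitGainGraph

open Classical in
/-- The adjacency matrix of a complex unit gain graph. -/
noncomputable def adjMatrix {V : Type*} (Φ : UnitGainGraph V) : Matrix V V ℂ :=
  Matrix.of fun u v => if h : Φ.graph.Adj u v then (Φ.gain ⟨(u, v), h⟩ : ℂ) else 0

theorem isHermitian_adjMatrix {V : Type*} (Φ : UnitGainGraph V) : Φ.adjMatrix.IsHermitian := by
  ext u v
  by_cases h : Φ.graph.Adj v u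
  · have key := Φ.gain_symm ⟨(v, u), h⟩
    have e : (⟨(v, u), h⟩ : Φ.graph.Dart).symm = ⟨(u, v), h.symm⟩ := rfl
    rw [e] at key
    simp [adjMatrix, Matrix.conjTranspose_apply, h, h.symm, key, Circle.coe_inv_eq_conj, -Circle.coe_inv]
  · have h2 : ¬ Φ.graph.Adj u v := fun h3 => h h3.symm
    simp [adjMatrix, Matrix.conjTranspose_apply, h, h2]

open Classical in
/-- The negative inertia index: the number of negative eigenvalues of the adjacency matrix,
counted with multiplicity. -/
noncomputable def negInertia {V : Type*} [Fintype V] (Φ : UnitGainGraph V) : ℕ :=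
  Fintype.card {i : V // Φ.isHermitian_adjMatrix.eigenvalues i < 0}

/-- The gain `φ(v₁v₂) φ(v₂v₃) ⋯` of a walk. -/
noncomputable def walkGain {V : Type*} (Φ : UnitGainGraph V) {u v : V}
    (p : Φ.graph.Walk u v) : ℂ :=
  ((p.darts.map Φ.gain).prod : Circle)

/-- A cycle of Type D, traversed by the closed walk `p`. The condition does not depend on the
base point, nor on the direction, since reversal conjugates the gain. -/
def IsTypeD {V : Type*} (Φ : UnitGainGraph V) {u : V} (p : Φ.graph.Walk u u) : Prop :=
  Odd p.length ∧ ((-1 : ℂ) ^ ((p.length - 1) / 2) * Φ.walkGain p).re < 0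

end UnitGainGraph

/-! Write n, m, c for the negative inertia index, the matching number and the cyclomatic number. By
Sylvester's law n is the largest dimension of a negative definite subspace
(`IsHermitian.negIndex_eq`), so deleting a vertex lowers n by at most one. Deleting the neighbour of
a pendant vertex lowers it by at least one. Vertices are deleted by removing their edges: the
remaining isolated vertices affect none of n, m, c, and all graphs stay on `V` with weights taken
from one matrix `B`.

Upper bound n ≤ m + c: a forest has a vertex cover of size at most m (König), and deleting it leaves
the zero matrix. In a graph with a cycle, deleting a cycle vertex costs n at most one and c at least
one. If two distinct cycles meet, some vertex costs c at least two, so equality forces (a).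

Sufficiency: an isolated odd cycle of length 2l+1 and Type D adds l+1 to n, that is its matching
number plus one. The contracted graph is a forest, so König gives it a cover of size at most m(T_G).
Under (c) each edge of a maximum matching off the cycles contains a cover vertex, and counting shows
that these are all the cover vertices. So the bridges of G are covered by a set K of vertices off
the cycles, matched to vertices whose neighbours all lie in K. Eliminating K costs n at least |K|, m
at most |K| and c nothing, and leaves disjoint Type D cycles (`le_negIndex_of_cover`).

Necessity: a leaf of the forest T_G yields a pendant vertex of G or a cycle attached by at most one
edge. Deleting the neighbour of the pendant vertex, or the attaching vertex of the cycle, preserves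
equality. Induction gives (b) and m(G) ≤ m(cycle edges) + m(G - O(G))
(`allTypeD_and_matchingNumber_le`). Since odd cycles have near perfect matchings missing any
prescribed vertex, m(T_G) + m(cycle edges) ≤ m(G), and (c) follows. -/

/-! ### Negative inertia of Hermitian matrices. -/

namespace Matrix

open _root_.Matrix _root_.Module

variable {V : Type*} [Fintype V]

/-- The real quadratic form of a Hermitian matrix. -/
noncomputable def hermForm (A : Matrix V V ℂ) (z : V → ℂ) : ℝ := (star z ⬝ᵥ A *ᵥ z).re

/-- The form of `A` is negative definite on the subspace `U`. -/
def IsNegOn (A : Matrix V V ℂ) (U : Submodule ℂ (V → ℂ)) : Prop :=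
  ∀ z ∈ U, z ≠ 0 → A.hermForm z < 0

/-- The largest dimension of a subspace on which the form of `A` is negative definite. -/
noncomputable def negIndex (A : Matrix V V ℂ) : ℕ :=
  sSup {k | ∃ U : Submodule ℂ (V → ℂ), A.IsNegOn U ∧ finrank ℂ U = k}

@[simp] lemma hermForm_zero (A : Matrix V V ℂ) : A.hermForm 0 = 0 := by simp [hermForm]

lemma bddAbove_negOn (A : Matrix V V ℂ) :
    BddAbove {k | ∃ U : Submodule ℂ (V → ℂ), A.IsNegOn U ∧ finrank ℂ U = k} := by
  refine ⟨finrank ℂ (V → ℂ), ?_⟩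
  rintro k ⟨U, -, rfl⟩
  exact Submodule.finrank_le U

lemma IsNegOn.finrank_le {A : Matrix V V ℂ} {U : Submodule ℂ (V → ℂ)} (h : A.IsNegOn U) :
    finrank ℂ U ≤ A.negIndex :=
  le_csSup A.bddAbove_negOn ⟨U, h, rfl⟩

lemma exists_isNegOn (A : Matrix V V ℂ) :
    ∃ U : Submodule ℂ (V → ℂ), A.IsNegOn U ∧ finrank ℂ U = A.negIndex := by
  refine Nat.sSup_mem (s := {k | ∃ U : Submodule ℂ (V → ℂ), A.IsNegOn U ∧ finrank ℂ U = k})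
    ⟨0, ⊥, ?_, by simp⟩ A.bddAbove_negOn
  intro z hz h0
  exact absurd ((Submodule.mem_bot ℂ).1 hz) h0

/-- The form vanishes at zero, so negativity off zero already makes `f` injective; negative
subspaces can thus be given by parametrizations. -/
lemma finrank_le_negIndex {E : Type*} [AddCommGroup E] [Module ℂ E] [FiniteDimensional ℂ E]
    (A : Matrix V V ℂ) (f : E →ₗ[ℂ] (V → ℂ)) (h : ∀ z, z ≠ 0 → A.hermForm (f z) < 0) :
    finrank ℂ E ≤ A.negIndex := by
  have hf : Function.Injective f := by
    rw [← LinearMap.ker_eq_bot, LinearMap.ker_eq_bot']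
    intro z hz
    by_contra h0
    have := h z h0
    rw [hz, hermForm_zero] at this
    exact lt_irrefl _ this
  rw [← LinearMap.finrank_range_of_inj hf]
  apply IsNegOn.finrank_le
  rintro _ ⟨z, rfl⟩ h0
  exact h z fun h1 => h0 (by rw [h1, map_zero])

lemma negIndex_le_of_map {A A' : Matrix V V ℂ} (f : (V → ℂ) →ₗ[ℂ] (V → ℂ))
    (h : ∀ z, A.hermForm z < 0 → A'.hermForm (f z) < 0) : A.negIndex ≤ A'.negIndex := by
  obtain ⟨U, hU, hk⟩ := A.exists_isNegOn
  rw [← hk]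
  refine finrank_le_negIndex A' (f ∘ₗ U.subtype) fun z hz => h _ (hU _ z.2 ?_)
  simpa using hz

/-- A negative definite subspace meets the hyperplane `z v = 0` in codimension at most one. -/
lemma negIndex_le_add_one {A A' : Matrix V V ℂ} (v : V)
    (h : ∀ z : V → ℂ, z v = 0 → A'.hermForm z = A.hermForm z) :
    A.negIndex ≤ A'.negIndex + 1 := by
  obtain ⟨U, hU, hk⟩ := A.exists_isNegOn
  rw [← hk]
  let p : U →ₗ[ℂ] ℂ := (LinearMap.proj v) ∘ₗ U.subtype
  have h1 := LinearMap.finrank_range_add_finrank_ker p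
  have h2 : finrank ℂ (LinearMap.range p) ≤ 1 := by
    simpa using Submodule.finrank_le (LinearMap.range p)
  have h3 : finrank ℂ (LinearMap.ker p) ≤ A'.negIndex := by
    have := finrank_le_negIndex (E := LinearMap.ker p) A'
      (LinearMap.domRestrict U.subtype (LinearMap.ker p)) fun z hz => ?_
    · exact this
    have hz0 : (z : V → ℂ) v = 0 := z.2
    have : A'.hermForm (z : V → ℂ) < 0 := by
      rw [h _ hz0]
      exact hU _ z.1.2 (by simpa using hz)
    exact this
  omega

lemma IsHermitian.dotProduct_mulVec_swap {A : Matrix V V ℂ} (hA : A.IsHermitian) (x y : V → ℂ) :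
    star x ⬝ᵥ A *ᵥ y = star (star y ⬝ᵥ A *ᵥ x) := by
  rw [star_dotProduct, star_mulVec, hA.eq, ← dotProduct_mulVec]

lemma IsHermitian.hermForm_add_smul {A : Matrix V V ℂ} (hA : A.IsHermitian) (x g : V → ℂ)
    (h : star x ⬝ᵥ A *ᵥ g = 0) (c : ℂ) :
    A.hermForm (x + c • g) = A.hermForm x + Complex.normSq c * A.hermForm g := by
  have h' : star g ⬝ᵥ A *ᵥ x = 0 := by rw [hA.dotProduct_mulVec_swap, h, star_zero]
  have hc : star c * c = (Complex.normSq c : ℂ) := Complex.normSq_eq_conj_mul_self.symm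
  simp only [hermForm, star_add, star_smul, mulVec_add, mulVec_smul, add_dotProduct,
    dotProduct_add, smul_dotProduct, dotProduct_smul, h, h', smul_eq_mul, mul_zero, add_zero,
    zero_add, ← mul_assoc, Complex.add_re]
  rw [mul_comm c, hc, Complex.re_ofReal_mul]

/-- The image under `f` of a negative subspace for `A'` is enlarged by the line of `g`, which is
negative and orthogonal to it for `A`. -/
lemma negIndex_add_one_le {A A' : Matrix V V ℂ} (hA : A.IsHermitian)
    (f : (V → ℂ) →ₗ[ℂ] (V → ℂ)) (g : V → ℂ) (hf : ∀ z, A.hermForm (f z) = A'.hermForm z)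
    (hg : A.hermForm g < 0) (hfg : ∀ z, star (f z) ⬝ᵥ A *ᵥ g = 0) :
    A'.negIndex + 1 ≤ A.negIndex := by
  obtain ⟨U, hU, hk⟩ := A'.exists_isNegOn
  have h1 : finrank ℂ (U × ℂ) = A'.negIndex + 1 := by rw [finrank_prod, hk, finrank_self]
  rw [← h1]
  refine finrank_le_negIndex A
    (LinearMap.coprod (f ∘ₗ U.subtype) (LinearMap.toSpanSingleton ℂ (V → ℂ) g)) ?_
  rintro ⟨z, c⟩ hzc
  have : A.hermForm (f z + c • g) < 0 := by
    rw [hA.hermForm_add_smul _ _ (hfg z), hf]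
    by_cases hz : z = 0
    · have hc : c ≠ 0 := by
        rintro rfl
        exact hzc (by rw [hz]; rfl)
      subst hz
      simp only [ZeroMemClass.coe_zero, hermForm_zero, zero_add]
      exact mul_neg_of_pos_of_neg (Complex.normSq_pos.2 hc) hg
    · have := hU z z.2 (by simpa using hz)
      nlinarith [Complex.normSq_nonneg c]
  simpa using this

open Classical in
/-- The matrix obtained by replacing the row and the column of `v` by zero. -/
noncomputable def zeroAt (A : Matrix V V ℂ) (v : V) : Matrix V V ℂ :=
  Matrix.of fun i j => if i = v ∨ j = v then 0 else A i j

open Classical in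
/-- Replacing the coordinate `v` by zero. -/
noncomputable def dropCoord (v : V) : (V → ℂ) →ₗ[ℂ] (V → ℂ) where
  toFun z := Function.update z v 0
  map_add' x y := by
    ext i; by_cases h : i = v
    · subst h; simp
    · simp [h]
  map_smul' c x := by
    ext i; by_cases h : i = v
    · subst h; simp
    · simp [h]

omit [Fintype V] in
@[simp] lemma dropCoord_self (v : V) (z : V → ℂ) : dropCoord v z v = 0 := by simp [dropCoord]

omit [Fintype V] in
lemma dropCoord_of_ne {v w : V} (h : w ≠ v) (z : V → ℂ) : dropCoord v z w = z w := by
  simp [dropCoord, h]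

lemma hermForm_zeroAt (A : Matrix V V ℂ) (v : V) (z : V → ℂ) :
    (A.zeroAt v).hermForm z = A.hermForm (dropCoord v z) := by
  classical
  unfold hermForm
  congr 1
  simp only [dotProduct, mulVec, Finset.mul_sum]
  refine Finset.sum_congr rfl fun i _ => Finset.sum_congr rfl fun j _ => ?_
  by_cases hi : i = v
  · subst hi; simp [zeroAt]
  by_cases hj : j = v
  · subst hj; simp [zeroAt]
  simp [zeroAt, hi, hj, dropCoord_of_ne]

omit [Fintype V] in
lemma dropCoord_eq_self {v : V} {z : V → ℂ} (h : z v = 0) : dropCoord v z = z := by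
  ext i; by_cases hi : i = v
  · subst hi; simp [h]
  · simp [dropCoord_of_ne hi]

lemma negIndex_le_zeroAt_add_one (A : Matrix V V ℂ) (v : V) :
    A.negIndex ≤ (A.zeroAt v).negIndex + 1 :=
  negIndex_le_add_one v fun z hz => by rw [hermForm_zeroAt, dropCoord_eq_self hz]

/-- Since `A *ᵥ g` is supported at `v`, the vector `g` is orthogonal to the hyperplane `z v = 0`, on
which the form of `A` is that of `A.zeroAt v`. -/
lemma negIndex_zeroAt_add_one_le {A : Matrix V V ℂ} (hA : A.IsHermitian) (v : V) (g : V → ℂ)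
    (hg : ∀ w, w ≠ v → (A *ᵥ g) w = 0) (hneg : A.hermForm g < 0) :
    (A.zeroAt v).negIndex + 1 ≤ A.negIndex := by
  refine negIndex_add_one_le hA (dropCoord v) g (fun z => (hermForm_zeroAt A v z).symm) hneg
    fun z => ?_
  refine Finset.sum_eq_zero fun i _ => ?_
  by_cases hi : i = v
  · subst hi; simp
  · rw [hg i hi, mul_zero]

/-- Projection along `g` to the hyperplane `z v = 0` is orthogonal for `A`. The form at `z` is that
of the projection plus a nonnegative term, so negative vectors project to negative ones. -/
lemma negIndex_le_zeroAt {A : Matrix V V ℂ} (hA : A.IsHermitian) (v : V) (g : V → ℂ)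
    (hgv : g v = 1) (hg : ∀ w, w ≠ v → (A *ᵥ g) w = 0) (hnonneg : 0 ≤ A.hermForm g) :
    A.negIndex ≤ (A.zeroAt v).negIndex := by
  let f : (V → ℂ) →ₗ[ℂ] (V → ℂ) :=
    LinearMap.id - (LinearMap.proj (R := ℂ) (φ := fun _ : V => ℂ) v).smulRight g
  refine negIndex_le_of_map f fun z hz => ?_
  set w : V → ℂ := z - z v • g with hw
  have hfz : f z = w := rfl
  have hwv : w v = 0 := by simp [hw, hgv]
  have hwg : star w ⬝ᵥ A *ᵥ g = 0 := by
    refine Finset.sum_eq_zero fun i _ => ?_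
    by_cases hi : i = v
    · subst hi; simp [hwv]
    · rw [hg i hi, mul_zero]
  have hz' : z = w + z v • g := by simp [hw]
  rw [hz', hA.hermForm_add_smul _ _ hwg] at hz
  rw [hfz, hermForm_zeroAt, dropCoord_eq_self hwv]
  have := mul_nonneg (Complex.normSq_nonneg (z v)) hnonneg
  linarith

/-- The coordinates `x` and `y` span a hyperbolic plane, which splits off and accounts for one
negative direction. Its orthogonal complement carries the form with `y` deleted. -/
lemma negIndex_zeroAt_add_one_le_of_pendant {A : Matrix V V ℂ} (hA : A.IsHermitian) {x y : V}
    (hxy : x ≠ y) (h : ∀ j, j ≠ y → A x j = 0) (hyy : A y y = 0) (hne : A x y ≠ 0) :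
    (A.zeroAt y).negIndex + 1 ≤ A.negIndex := by
  classical
  have hyx : A y x = star (A x y) := (hA.apply y x).symm
  have hyx0 : A y x ≠ 0 := by rw [hyx]; simpa using hne
  have hAx : ∀ z : V → ℂ, (A *ᵥ z) x = A x y * z y := fun z => by
    rw [mulVec, dotProduct, Finset.sum_eq_single y (fun j _ hj => by rw [h j hj, zero_mul])
      (fun hn => absurd (Finset.mem_univ _) hn)]
  let e : V → ℂ := Pi.single x 1
  have he : ∀ z : V → ℂ, z y = 0 → star z ⬝ᵥ A *ᵥ e = 0 := fun z hz => by
    rw [hA.dotProduct_mulVec_swap]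
    simp [e, hAx, hz, dotProduct, Pi.single_apply, apply_ite]
  have hform : ∀ (z : V → ℂ) (c : ℂ), z y = 0 → A.hermForm (z + c • e) = A.hermForm z :=
    fun z c hz => by
      rw [hA.hermForm_add_smul _ _ (he z hz)]
      have : A.hermForm e = 0 := by
        unfold hermForm
        rw [he e (by simp [e, hxy.symm])]; rfl
      rw [this, mul_zero, add_zero]
  -- Subtracting `L z • e` makes entry `y` of the image under `A` vanish. It does not alter the
  -- form, because `e` is isotropic and orthogonal to vectors vanishing at `y`.
  let L : (V → ℂ) →ₗ[ℂ] ℂ :=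
    (A y x)⁻¹ • ((LinearMap.proj (R := ℂ) (φ := fun _ : V => ℂ) y) ∘ₗ A.mulVecLin ∘ₗ
      (dropCoord y))
  let f : (V → ℂ) →ₗ[ℂ] (V → ℂ) := dropCoord y - L.smulRight e
  have hf : ∀ z, f z = dropCoord y z + (-((A y x)⁻¹ * (A *ᵥ dropCoord y z) y)) • e := by
    intro z
    simp [f, L, sub_eq_add_neg]
  have hfy : ∀ z, f z y = 0 := fun z => by rw [hf]; simp [e, hxy.symm]
  have hAf : ∀ z, (A *ᵥ f z) y = 0 := fun z => by
    rw [hf, mulVec_add, mulVec_smul]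
    have : (A *ᵥ e) y = A y x := by simp [e]
    simp only [Pi.add_apply, Pi.smul_apply, this, smul_eq_mul]
    field_simp
    ring
  have hAg : ∀ z : V → ℂ, star (Pi.single y 1 + (-A x y) • e) ⬝ᵥ z
      = z y + star (-A x y) * z x := fun z => by
    rw [star_add, add_dotProduct, star_smul, smul_dotProduct]
    simp [e, dotProduct, Pi.single_apply, apply_ite]
  -- The form takes the value `-2 * |A x y| ^ 2` at this vector.
  refine negIndex_add_one_le hA f (Pi.single y 1 + (-A x y) • e) (fun z => ?_) ?_ fun z => ?_
  · rw [hermForm_zeroAt, hf, hform _ _ (dropCoord_self y z)]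
  · unfold hermForm
    rw [hAg, hAx, mulVec_add, mulVec_smul]
    have h1 : (A *ᵥ e) y = A y x := by simp [e]
    have h2 : (A *ᵥ Pi.single y 1) y = 0 := by simp [hyy]
    simp only [Pi.add_apply, Pi.smul_apply, h1, h2, smul_eq_mul, hyx]
    have h3 : 0 < Complex.normSq (A x y) := Complex.normSq_pos.2 hne
    have h4 : e y = 0 := by simp [e, hxy.symm]
    simp only [h4, Pi.single_eq_same, Complex.star_def]
    rw [Complex.normSq_apply] at h3
    simp
    nlinarith
  · rw [hA.dotProduct_mulVec_swap, hAg, hAf, hAx, hfy]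
    simp

lemma hermForm_diagonal [DecidableEq V] (d : V → ℝ) (z : V → ℂ) :
    (diagonal (fun i => (d i : ℂ))).hermForm z = ∑ i, d i * Complex.normSq (z i) := by
  simp only [hermForm, dotProduct, mulVec_diagonal, Complex.re_sum]
  refine Finset.sum_congr rfl fun i _ => ?_
  simp [Complex.normSq_apply]
  ring

lemma negIndex_diagonal [DecidableEq V] (d : V → ℝ) :
    (diagonal (fun i => (d i : ℂ))).negIndex = Fintype.card {i : V // d i < 0} := by
  apply le_antisymm
  · obtain ⟨U, hU, hk⟩ := (diagonal (fun i => (d i : ℂ))).exists_isNegOn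
    rw [← hk, ← finrank_fintype_fun_eq_card (R := ℂ) (η := {i : V // d i < 0})]
    -- Restriction to the negative coordinates is injective on `U`: the form is nonnegative at a
    -- vector vanishing on all of them.
    let f : U →ₗ[ℂ] ({i : V // d i < 0} → ℂ) :=
      (LinearMap.funLeft ℂ ℂ (Subtype.val : {i : V // d i < 0} → V)) ∘ₗ U.subtype
    refine LinearMap.finrank_le_finrank_of_injective (f := f) ?_
    rw [← LinearMap.ker_eq_bot, LinearMap.ker_eq_bot']
    intro z hz
    by_contra h0
    have h1 := hU z z.2 (by simpa using h0)
    rw [hermForm_diagonal] at h1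
    refine absurd h1 (not_lt.2 (Finset.sum_nonneg fun i _ => ?_))
    by_cases hi : d i < 0
    · have : (z : V → ℂ) i = 0 := congrFun hz ⟨i, hi⟩
      simp [this]
    · exact mul_nonneg (not_lt.1 hi) (Complex.normSq_nonneg _)
  · rw [← finrank_fintype_fun_eq_card (R := ℂ) (η := {i : V // d i < 0})]
    refine finrank_le_negIndex _
      (Function.ExtendByZero.linearMap ℂ (Subtype.val : {i : V // d i < 0} → V)) fun z hz => ?_
    have hz' : ∀ i : {i : V // d i < 0},
        Function.ExtendByZero.linearMap ℂ (Subtype.val : {i : V // d i < 0} → V) z i = z i :=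
      fun i => Subtype.val_injective.extend_apply _ _ _
    have hz0 : ∀ i : V, ¬ d i < 0 →
        Function.ExtendByZero.linearMap ℂ (Subtype.val : {i : V // d i < 0} → V) z i = 0 :=
      fun i hi => Function.extend_apply' _ _ _ (by rintro ⟨a, rfl⟩; exact hi a.2)
    rw [hermForm_diagonal]
    obtain ⟨j, hj⟩ := Function.ne_iff.1 hz
    refine Finset.sum_neg' (fun i _ => ?_) ⟨j, Finset.mem_univ _, ?_⟩
    · by_cases hi : d i < 0
      · exact mul_nonpos_of_nonpos_of_nonneg hi.le (Complex.normSq_nonneg _)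
      · rw [hz0 i hi]; simp
    · rw [hz' j]
      exact mul_neg_of_neg_of_pos j.2 (Complex.normSq_pos.2 hj)

lemma hermForm_conj (A P : Matrix V V ℂ) (z : V → ℂ) :
    (Pᴴ * A * P).hermForm z = A.hermForm (P *ᵥ z) := by
  unfold hermForm
  rw [star_mulVec, ← mulVec_mulVec, ← mulVec_mulVec, ← dotProduct_mulVec]

/-- The unitary of eigenvectors and its adjoint carry negative vectors of `A` and of the diagonal
matrix of its eigenvalues to each other. -/
lemma IsHermitian.negIndex_eq [DecidableEq V] {A : Matrix V V ℂ} (hA : A.IsHermitian) :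
    A.negIndex = Fintype.card {i : V // hA.eigenvalues i < 0} := by
  rw [← negIndex_diagonal]
  have h1 : A = (hA.eigenvectorUnitary : Matrix V V ℂ) *
      diagonal (fun i => (hA.eigenvalues i : ℂ)) * (hA.eigenvectorUnitary : Matrix V V ℂ)ᴴ := by
    conv_lhs => rw [hA.spectral_theorem]
    rfl
  have h2 : diagonal (fun i => (hA.eigenvalues i : ℂ)) =
      (hA.eigenvectorUnitary : Matrix V V ℂ)ᴴ * A * (hA.eigenvectorUnitary : Matrix V V ℂ) := by
    have := hA.conjStarAlgAut_star_eigenvectorUnitary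
    rw [Unitary.conjStarAlgAut_star_apply] at this
    exact this.symm
  apply le_antisymm
  · refine negIndex_le_of_map ((hA.eigenvectorUnitary : Matrix V V ℂ)ᴴ).mulVecLin fun z hz => ?_
    rw [mulVecLin_apply, ← hermForm_conj, conjTranspose_conjTranspose, ← h1]
    exact hz
  · refine negIndex_le_of_map (hA.eigenvectorUnitary : Matrix V V ℂ).mulVecLin fun z hz => ?_
    rw [mulVecLin_apply, ← hermForm_conj, ← h2]
    exact hz

end Matrix

/-! ### Isolated vertices, cycles, bridges and the cyclomatic number. -/

namespace SimpleGraph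

variable {V : Type*} {G H : SimpleGraph V}

/-! ### Isolating a set of vertices -/

/-- The graph on the same vertices obtained by deleting all edges meeting `S`. -/
def isolate (G : SimpleGraph V) (S : Set V) : SimpleGraph V where
  Adj u v := G.Adj u v ∧ u ∉ S ∧ v ∉ S
  symm.symm _ _ h := ⟨h.1.symm, h.2.2, h.2.1⟩
  loopless.irrefl _ h := h.1.ne rfl

@[simp] lemma isolate_adj {S : Set V} {u v : V} :
    (G.isolate S).Adj u v ↔ G.Adj u v ∧ u ∉ S ∧ v ∉ S := Iff.rfl

lemma isolate_le (S : Set V) : G.isolate S ≤ G := fun _ _ h => h.1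

lemma isolate_isolate (S T : Set V) : (G.isolate S).isolate T = G.isolate (S ∪ T) := by
  ext u v
  simp only [isolate_adj, Set.mem_union]
  tauto

lemma isolate_mono (h : H ≤ G) {S T : Set V} (hST : S ⊆ T) : H.isolate T ≤ G.isolate S :=
  fun _ _ ha => ⟨h ha.1, fun hs => ha.2.1 (hST hs), fun hs => ha.2.2 (hST hs)⟩

lemma isolate_lt {S : Set V} {u v : V} (h : G.Adj u v) (hu : u ∈ S) : G.isolate S < G :=
  (isolate_le S).lt_of_ne fun he => by
    rw [← he] at h
    exact h.2.1 hu

/-! ### Cycles -/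

lemma Walk.forall_support_of_edges {x y : V} (p : G.Walk x y) (P : V → Prop) (hx : P x)
    (h : ∀ a b, s(a, b) ∈ p.edges → P a → P b) : ∀ z ∈ p.support, P z := by
  induction p with
  | nil => simpa using hx
  | cons hadj p ih =>
    intro z hz
    rw [Walk.support_cons, List.mem_cons] at hz
    rcases hz with rfl | hz
    · exact hx
    · exact ih (h _ _ (by simp) hx) (fun a b hab => h a b (by simp [hab])) z hz

lemma Walk.IsCycle.exists_mem_edges {u x : V} {p : G.Walk u u} (hp : p.IsCycle)
    (hx : x ∈ p.support) : ∃ y, s(x, y) ∈ p.edges := by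
  classical
  have hc := (Walk.isCycle_rotate hx).2 hp
  refine ⟨(p.rotate x hx).snd, ?_⟩
  rw [← (p.rotate_edges x hx).mem_iff]
  exact Walk.mk_start_snd_mem_edges hc.not_nil

lemma exists_isCycle_of_not_isBridge {e : Sym2 V} (he : e ∈ G.edgeSet) (h : ¬ G.IsBridge e) :
    ∃ (u : V) (p : G.Walk u u), p.IsCycle ∧ e ∈ p.edges := by
  rw [isBridge_iff_forall_cycle_notMem he] at h
  push Not at h
  exact h

lemma Walk.edges_subset_of_support_disjoint {u v : V} (p : G.Walk u v) {S : Set V}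
    (h : ∀ x ∈ p.support, x ∉ S) : ∀ e ∈ p.edges, e ∈ (G.isolate S).edgeSet := by
  intro e he
  induction e with | h a b
  exact ⟨p.adj_of_mem_edges he, h _ (p.fst_mem_support_of_mem_edges he),
    h _ (p.snd_mem_support_of_mem_edges he)⟩

/-- Two cycles which share a vertex have the same edges. -/
def CyclesDisjoint (G : SimpleGraph V) : Prop :=
  ∀ ⦃u v : V⦄ (p : G.Walk u u) (q : G.Walk v v), p.IsCycle → q.IsCycle →
    ∀ x, x ∈ p.support → x ∈ q.support → ∀ e ∈ p.edges, e ∈ q.edges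

lemma CyclesDisjoint.anti (hG : G.CyclesDisjoint) (h : H ≤ G) : H.CyclesDisjoint := by
  intro u v p q hp hq x hxp hxq e he
  have := hG (p.mapLe h) (q.mapLe h) ((Walk.isCycle_mapLe h).2 hp) ((Walk.isCycle_mapLe h).2 hq)
    x (by simpa using hxp) (by simpa using hxq) e (by simpa using he)
  simpa using this

lemma CyclesDisjoint.support_subset (hG : G.CyclesDisjoint) {u v : V} {p : G.Walk u u}
    {q : G.Walk v v} (hp : p.IsCycle) (hq : q.IsCycle) {x : V} (hxp : x ∈ p.support)
    (hxq : x ∈ q.support) : ∀ z ∈ p.support, z ∈ q.support := by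
  intro z hz
  obtain ⟨y, hy⟩ := hp.exists_mem_edges hz
  exact q.fst_mem_support_of_mem_edges (hG p q hp hq x hxp hxq _ hy)

/-- Each vertex of a cycle lies on one of its edges, so cycles with the same edges are equal as
subgraphs. -/
lemma disjointCycles_iff : G.DisjointCycles ↔ G.CyclesDisjoint := by
  constructor
  · intro h u v p q hp hq x hxp hxq e he
    by_cases heq : p.toSubgraph = q.toSubgraph
    · rw [← Walk.mem_edges_toSubgraph, ← heq, Walk.mem_edges_toSubgraph]
      exact he
    · have := h _ _ ⟨u, p, hp, rfl⟩ ⟨v, q, hq, rfl⟩ heq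
      exact (Set.disjoint_left.1 this (p.mem_verts_toSubgraph.2 hxp)
        (q.mem_verts_toSubgraph.2 hxq)).elim
  · rintro h _ _ ⟨u, p, hp, rfl⟩ ⟨v, q, hq, rfl⟩ hne
    rw [Set.disjoint_left]
    intro x hxp hxq
    rw [Walk.mem_verts_toSubgraph] at hxp hxq
    apply hne
    ext a b
    · rw [Walk.mem_verts_toSubgraph, Walk.mem_verts_toSubgraph]
      exact ⟨h.support_subset hp hq hxp hxq a, h.support_subset hq hp hxq hxp a⟩
    · rw [Walk.adj_toSubgraph_iff_mem_edges, Walk.adj_toSubgraph_iff_mem_edges]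
      exact ⟨h p q hp hq x hxp hxq _, h q p hq hp x hxq hxp _⟩

lemma mem_cycleVerts_iff {x : V} :
    x ∈ G.cycleVerts ↔ ∃ (u : V) (p : G.Walk u u), p.IsCycle ∧ x ∈ p.support := by
  constructor
  · rintro ⟨_, ⟨u, p, hp, rfl⟩, hx⟩
    exact ⟨u, p, hp, p.mem_verts_toSubgraph.1 hx⟩
  · rintro ⟨u, p, hp, hx⟩
    exact ⟨_, ⟨u, p, hp, rfl⟩, p.mem_verts_toSubgraph.2 hx⟩

lemma isBridge_of_notMem_cycleVerts {x y : V} (hxy : G.Adj x y) (hx : x ∉ G.cycleVerts) :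
    G.IsBridge s(x, y) := by
  by_contra h
  obtain ⟨u, p, hp, he⟩ := exists_isCycle_of_not_isBridge (G.mem_edgeSet.2 hxy) h
  exact hx (mem_cycleVerts_iff.2 ⟨u, p, hp, p.fst_mem_support_of_mem_edges he⟩)

/-- The graph formed by the edges lying on cycles. -/
def cyclePart (G : SimpleGraph V) : SimpleGraph V where
  Adj u v := G.Adj u v ∧ ¬ G.IsBridge s(u, v)
  symm.symm _ _ h := ⟨h.1.symm, by rw [Sym2.eq_swap]; exact h.2⟩
  loopless.irrefl _ h := h.1.ne rfl

lemma cyclePart_le : G.cyclePart ≤ G := fun _ _ h => h.1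

lemma cyclePart_mono (h : H ≤ G) : H.cyclePart ≤ G.cyclePart :=
  fun _ _ ha => ⟨h ha.1, fun hb => ha.2 (hb.anti h)⟩

lemma Walk.IsCycle.edges_subset_cyclePart {u : V} {p : G.Walk u u} (hp : p.IsCycle) :
    ∀ e ∈ p.edges, e ∈ G.cyclePart.edgeSet := by
  intro e he
  induction e with | h a b
  exact ⟨p.adj_of_mem_edges he, fun hb => hb.notMem_edges_of_isCycle hp he⟩

/-! ### The cyclomatic number -/

section Cyclomatic

variable [Finite V]

omit [Finite V] in
lemma reachable_deleteEdges_cases (u v : V) {a b : V} (h : G.Reachable a b) :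
    (G.deleteEdges {s(u, v)}).Reachable a b ∨
      ((G.deleteEdges {s(u, v)}).Reachable a u ∧ (G.deleteEdges {s(u, v)}).Reachable v b) ∨
      ((G.deleteEdges {s(u, v)}).Reachable a v ∧ (G.deleteEdges {s(u, v)}).Reachable u b) := by
  obtain ⟨p⟩ := h
  induction p with
  | nil => exact Or.inl (Reachable.refl _)
  | @cons a x b hax p ih =>
    by_cases he : s(a, x) = s(u, v)
    · rw [Sym2.eq_iff] at he
      rcases he with ⟨rfl, rfl⟩ | ⟨rfl, rfl⟩
      · rcases ih with ih | ih | ih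
        · exact Or.inr (Or.inl ⟨.refl _, ih⟩)
        · exact Or.inr (Or.inl ⟨.refl _, ih.2⟩)
        · exact Or.inl ih.2
      · rcases ih with ih | ih | ih
        · exact Or.inr (Or.inr ⟨.refl _, ih⟩)
        · exact Or.inl ih.2
        · exact Or.inr (Or.inr ⟨.refl _, ih.2⟩)
    · have h1 : (G.deleteEdges {s(u, v)}).Reachable a x :=
        Adj.reachable (deleteEdges_adj.2 ⟨hax, he⟩)
      rcases ih with ih | ih | ih
      · exact Or.inl (h1.trans ih)
      · exact Or.inr (Or.inl ⟨h1.trans ih.1, ih.2⟩)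
      · exact Or.inr (Or.inr ⟨h1.trans ih.1, ih.2⟩)

lemma card_connectedComponent_deleteEdges_of_not_isBridge {u v : V}
    (h : ¬ G.IsBridge s(u, v)) :
    Nat.card (G.deleteEdges {s(u, v)}).ConnectedComponent = Nat.card G.ConnectedComponent := by
  rw [isBridge_iff, not_not] at h
  refine le_antisymm ?_ (ConnectedComponent.card_le_card_of_le (deleteEdges_le _))
  refine Nat.card_le_card_of_injective
    (ConnectedComponent.map (Hom.ofLE (deleteEdges_le (G := G) {s(u, v)}))) fun a b => ?_
  induction a using ConnectedComponent.ind with | h a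
  induction b using ConnectedComponent.ind with | h b
  intro hab
  rw [ConnectedComponent.map_mk, ConnectedComponent.map_mk, ConnectedComponent.eq] at hab
  rw [ConnectedComponent.eq]
  rcases reachable_deleteEdges_cases u v hab with h1 | h1 | h1
  · exact h1
  · exact h1.1.trans (h.trans h1.2)
  · exact h1.1.trans (h.symm.trans h1.2)

lemma card_connectedComponent_deleteEdges_of_isBridge {u v : V} (hadj : G.Adj u v)
    (h : G.IsBridge s(u, v)) :
    Nat.card (G.deleteEdges {s(u, v)}).ConnectedComponent
      = Nat.card G.ConnectedComponent + 1 := by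
  classical
  rw [isBridge_iff] at h
  set G' := G.deleteEdges {s(u, v)} with hG'
  let π : G'.ConnectedComponent → G.ConnectedComponent :=
    ConnectedComponent.map (Hom.ofLE (deleteEdges_le (G := G) {s(u, v)}))
  have hπ : ∀ a, π (G'.connectedComponentMk a) = G.connectedComponentMk a := fun a => rfl
  have hsurj : Function.Surjective π := ConnectedComponent.surjective_map_ofLE _
  apply le_antisymm
  · rw [← Finite.card_option]
    refine Nat.card_le_card_of_injective
      (fun c => if c = G'.connectedComponentMk v then none else some (π c)) fun a b => ?_
    induction a using ConnectedComponent.ind with | h a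
    induction b using ConnectedComponent.ind with | h b
    intro hab
    simp only at hab
    split_ifs at hab with h1 h2 h2
    · rw [h1, h2]
    · rw [Option.some.injEq, hπ, hπ, ConnectedComponent.eq] at hab
      rw [ConnectedComponent.eq] at h1 h2 ⊢
      rcases reachable_deleteEdges_cases u v hab with h3 | h3 | h3
      · exact h3
      · exact absurd h3.2.symm h2
      · exact absurd h3.1 h1
  · by_contra hlt
    have hb := hsurj.bijective_of_nat_card_le (by omega)
    refine h ((ConnectedComponent.eq).1 (hb.1 ?_))
    rw [hπ, hπ, ConnectedComponent.eq]
    exact hadj.reachable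

lemma ncard_edgeSet_deleteEdges {e : Sym2 V} (he : e ∈ G.edgeSet) :
    (G.deleteEdges {e}).edgeSet.ncard + 1 = G.edgeSet.ncard := by
  rw [edgeSet_deleteEdges]
  exact Set.ncard_sdiff_singleton_add_one he

lemma cyclomaticNumber_deleteEdges_of_not_isBridge {e : Sym2 V} (he : e ∈ G.edgeSet)
    (h : ¬ G.IsBridge e) : (G.deleteEdges {e}).cyclomaticNumber + 1 = G.cyclomaticNumber := by
  have h1 := ncard_edgeSet_deleteEdges he
  induction e with | h u v
  have h2 := card_connectedComponent_deleteEdges_of_not_isBridge h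
  unfold cyclomaticNumber
  omega

lemma cyclomaticNumber_deleteEdges_of_isBridge {e : Sym2 V} (he : e ∈ G.edgeSet)
    (h : G.IsBridge e) : (G.deleteEdges {e}).cyclomaticNumber = G.cyclomaticNumber := by
  have h1 := ncard_edgeSet_deleteEdges he
  induction e with | h u v
  have h2 := card_connectedComponent_deleteEdges_of_isBridge (G.mem_edgeSet.1 he) h
  unfold cyclomaticNumber
  rw [h2, ← h1]
  push_cast
  ring

omit [Finite V] in
lemma deleteEdges_lt {e : Sym2 V} (he : e ∈ G.edgeSet) : G.deleteEdges {e} < G :=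
  (deleteEdges_le _).lt_of_ne fun h => by
    rw [← h, edgeSet_deleteEdges] at he
    exact he.2 rfl

omit [Finite V] in
lemma le_deleteEdges (h : H ≤ G) {e : Sym2 V} (he : e ∉ H.edgeSet) :
    H ≤ G.deleteEdges {e} := by
  intro a b hab
  refine deleteEdges_adj.2 ⟨h hab, ?_⟩
  rintro rfl
  exact he hab

/-- Edges are deleted one at a time: a bridge leaves the number unchanged, any other edge lowers it
by one. -/
lemma cyclomaticNumber_mono (h : H ≤ G) : H.cyclomaticNumber ≤ G.cyclomaticNumber := by
  induction G using WellFoundedLT.induction with | ind G ih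
  by_cases heq : G.edgeSet ⊆ H.edgeSet
  · rw [le_antisymm h (edgeSet_subset_edgeSet.1 heq)]
  · obtain ⟨e, he, heH⟩ := Set.not_subset.1 heq
    have h1 := ih _ (deleteEdges_lt he) (le_deleteEdges h heH)
    by_cases hb : G.IsBridge e
    · rwa [cyclomaticNumber_deleteEdges_of_isBridge he hb] at h1
    · have := cyclomaticNumber_deleteEdges_of_not_isBridge he hb
      omega

/-- A bridge stays a bridge when other edges are deleted, so no single deletion lowers the number.
-/
lemma cyclomaticNumber_le_of_isBridge (h : H ≤ G)
    (hb : ∀ e ∈ G.edgeSet, e ∉ H.edgeSet → G.IsBridge e) :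
    G.cyclomaticNumber ≤ H.cyclomaticNumber := by
  induction G using WellFoundedLT.induction with | ind G ih
  by_cases heq : G.edgeSet ⊆ H.edgeSet
  · rw [le_antisymm h (edgeSet_subset_edgeSet.1 heq)]
  · obtain ⟨e, he, heH⟩ := Set.not_subset.1 heq
    have h1 := ih _ (deleteEdges_lt he) (le_deleteEdges h heH) fun f hf hfH =>
      (hb f (edgeSet_mono (deleteEdges_le _) hf) hfH).anti (deleteEdges_le _)
    rwa [cyclomaticNumber_deleteEdges_of_isBridge he (hb e he heH)] at h1

omit [Finite V] in
lemma cyclomaticNumber_bot : (⊥ : SimpleGraph V).cyclomaticNumber = 0 := by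
  have : Nat.card (⊥ : SimpleGraph V).ConnectedComponent = Nat.card V := by
    refine (Nat.card_eq_of_bijective (⊥ : SimpleGraph V).connectedComponentMk ⟨?_, ?_⟩).symm
    · intro a b hab
      simpa using hab
    · exact fun c => c.exists_rep
  simp [cyclomaticNumber, this]

lemma cyclomaticNumber_nonneg : 0 ≤ G.cyclomaticNumber := by
  rw [← cyclomaticNumber_bot (V := V)]
  exact cyclomaticNumber_mono bot_le

omit [Finite V] in
lemma isolate_le_deleteEdges {S : Set V} {x y : V} (hx : x ∈ S) :
    G.isolate S ≤ G.deleteEdges {s(x, y)} :=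
  le_deleteEdges (isolate_le S) fun h => h.2.1 hx

lemma cyclomaticNumber_isolate_add_one_le {u x : V} {p : G.Walk u u} (hp : p.IsCycle)
    (hx : x ∈ p.support) {S : Set V} (hxS : x ∈ S) :
    (G.isolate S).cyclomaticNumber + 1 ≤ G.cyclomaticNumber := by
  obtain ⟨y, hy⟩ := hp.exists_mem_edges hx
  have h1 := cyclomaticNumber_mono (isolate_le_deleteEdges (G := G) (y := y) hxS)
  have h2 := cyclomaticNumber_deleteEdges_of_not_isBridge (p.edges_subset_edgeSet hy)
    fun hb => hb.notMem_edges_of_isCycle hp hy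
  omega

/-- The vertex is a point `a` of `q` where `p` leaves `q` along an edge `s(a, b)`. Deleting this
edge costs one; the cycle `q` through `a` survives, so isolating `a` costs one more. -/
lemma exists_cyclomaticNumber_isolate_add_two_le (h : ¬ G.CyclesDisjoint) :
    ∃ x, (G.isolate {x}).cyclomaticNumber + 2 ≤ G.cyclomaticNumber := by
  classical
  unfold CyclesDisjoint at h
  push Not at h
  obtain ⟨u, v, p, q, hp, hq, x, hxp, hxq, e, hep, heq⟩ := h
  obtain ⟨a, b, hab, haq, habq⟩ : ∃ a b, s(a, b) ∈ p.edges ∧ a ∈ q.support ∧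
      s(a, b) ∉ q.edges := by
    -- Otherwise a walk along `p` from `x` never leaves `q`, and all edges of `p`, among them `e`,
    -- belong to `q`.
    by_contra! hcon
    have h1 := (p.rotate x hxp).forall_support_of_edges (· ∈ q.support) hxq fun a b hab haq =>
      q.snd_mem_support_of_mem_edges
        (hcon a b ((p.rotate_edges x hxp).mem_iff.1 hab) haq)
    induction e with | h a b
    refine heq (hcon a b hep (h1 a ?_))
    rw [Walk.mem_support_rotate_iff]
    exact p.fst_mem_support_of_mem_edges hep
  refine ⟨a, ?_⟩
  have h1 := cyclomaticNumber_deleteEdges_of_not_isBridge (p.edges_subset_edgeSet hab)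
    fun hb => hb.notMem_edges_of_isCycle hp hab
  have hq' : ∀ f ∈ q.edges, f ∈ (G.deleteEdges {s(a, b)}).edgeSet := by
    intro f hf
    rw [edgeSet_deleteEdges]
    refine ⟨q.edges_subset_edgeSet hf, ?_⟩
    rintro rfl
    exact habq hf
  have h2 := cyclomaticNumber_isolate_add_one_le (hq.transfer hq') (x := a)
    (by rwa [Walk.support_transfer]) (Set.mem_singleton a)
  have h3 : G.isolate {a} ≤ (G.deleteEdges {s(a, b)}).isolate {a} := fun c d hcd =>
    ⟨isolate_le_deleteEdges (Set.mem_singleton a) hcd, hcd.2.1, hcd.2.2⟩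
  have := cyclomaticNumber_mono h3
  omega

end Cyclomatic

end SimpleGraph

/-! ### Matching numbers and König's theorem for forests. -/

namespace SimpleGraph

variable {V : Type*} {G H : SimpleGraph V}

/-- A finite set of pairwise disjoint edges of `G`. -/
def IsMatchingSet (G : SimpleGraph V) (M : Finset (Sym2 V)) : Prop :=
  (∀ e ∈ M, e ∈ G.edgeSet) ∧ ∀ e ∈ M, ∀ f ∈ M, ∀ v, v ∈ e → v ∈ f → e = f

lemma IsMatchingSet.mono {M : Finset (Sym2 V)} (hM : G.IsMatchingSet M)
    (h : ∀ e ∈ M, e ∈ H.edgeSet) : H.IsMatchingSet M := ⟨h, hM.2⟩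

lemma IsMatchingSet.subset {M N : Finset (Sym2 V)} (hM : G.IsMatchingSet M) (h : N ⊆ M) :
    G.IsMatchingSet N :=
  ⟨fun e he => hM.1 e (h he), fun e he f hf => hM.2 e (h he) f (h hf)⟩

section Finite

variable [Finite V]

lemma bddAbove_matching (G : SimpleGraph V) :
    BddAbove {k | ∃ M : G.Subgraph, M.IsMatching ∧ M.edgeSet.ncard = k} := by
  refine ⟨Nat.card (Sym2 V), ?_⟩
  rintro k ⟨M, -, rfl⟩
  rw [← Set.ncard_univ]
  exact Set.ncard_le_ncard (Set.subset_univ _)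

lemma IsMatchingSet.card_le {M : Finset (Sym2 V)} (hM : G.IsMatchingSet M) :
    M.card ≤ G.matchingNumber := by
  let N : G.Subgraph :=
    { verts := {v | ∃ e ∈ M, v ∈ e}
      Adj := fun a b => s(a, b) ∈ M
      adj_sub := fun h => hM.1 _ h
      edge_vert := fun {a b} h => ⟨s(a, b), h, Sym2.mem_mk_left a b⟩
      symm.symm := fun a b h => by rwa [Sym2.eq_swap] }
  refine le_csSup G.bddAbove_matching ⟨N, ?_, ?_⟩
  · rintro v ⟨e, he, hv⟩
    obtain ⟨w, rfl⟩ := Sym2.mem_iff_exists.1 hv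
    refine ⟨w, he, fun y hy => ?_⟩
    have := hM.2 _ hy _ he v (Sym2.mem_mk_left _ _) (Sym2.mem_mk_left _ _)
    exact Sym2.congr_right.1 this
  · rw [← Set.ncard_coe_finset]
    congr 1
    ext e
    induction e with | h a b
    rfl

lemma exists_isMatchingSet (G : SimpleGraph V) :
    ∃ M : Finset (Sym2 V), G.IsMatchingSet M ∧ M.card = G.matchingNumber := by
  have hne : {k | ∃ M : G.Subgraph, M.IsMatching ∧ M.edgeSet.ncard = k}.Nonempty :=
    ⟨_, ⊥, fun v hv => (hv : False).elim, rfl⟩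
  obtain ⟨N, hN, hk⟩ := Nat.sSup_mem hne G.bddAbove_matching
  have hfin : N.edgeSet.Finite := Set.toFinite _
  refine ⟨hfin.toFinset, ⟨fun e he => N.edgeSet_subset (hfin.mem_toFinset.1 he), ?_⟩, ?_⟩
  · intro e he f hf v hve hvf
    rw [hfin.mem_toFinset] at he hf
    obtain ⟨a, rfl⟩ := Sym2.mem_iff_exists.1 hve
    obtain ⟨b, rfl⟩ := Sym2.mem_iff_exists.1 hvf
    rw [Subgraph.mem_edgeSet] at he hf
    rw [(hN (N.edge_vert he)).unique he hf]
  · rw [← Set.ncard_eq_toFinset_card _ hfin]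
    exact hk

lemma matchingNumber_mono (h : H ≤ G) : H.matchingNumber ≤ G.matchingNumber := by
  obtain ⟨M, hM, hk⟩ := H.exists_isMatchingSet
  rw [← hk]
  exact (hM.mono fun e he => edgeSet_mono h (hM.1 e he)).card_le

omit [Finite V] in
lemma IsMatchingSet.card_le_card_of_cover (K : Finset V) (h : ∀ a b, G.Adj a b → a ∈ K ∨ b ∈ K)
    {M : Finset (Sym2 V)} (hM : G.IsMatchingSet M) : M.card ≤ K.card := by
  have : ∀ e ∈ M, ∃ v ∈ K, v ∈ e := by
    intro e he
    have := hM.1 e he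
    induction e with | h a b
    rcases h a b this with h | h
    · exact ⟨a, h, Sym2.mem_mk_left _ _⟩
    · exact ⟨b, h, Sym2.mem_mk_right _ _⟩
  refine Finset.card_le_card_of_forall_subsingleton (fun e v => v ∈ e) this ?_
  exact fun v _ e he f hf => hM.2 e he.1 f hf.1 v he.2 hf.2

/-- The edges of a maximum matching that miss `S` form a matching of the isolated graph; those that
meet `S` are bounded by `l`. -/
lemma matchingNumber_le_isolate_add_of_filter (S : Set V) (l : ℕ)
    (h : ∀ M : Finset (Sym2 V), G.IsMatchingSet M → (∀ e ∈ M, ∃ v ∈ e, v ∈ S) → M.card ≤ l) :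
    G.matchingNumber ≤ (G.isolate S).matchingNumber + l := by
  classical
  obtain ⟨M, hM, hk⟩ := G.exists_isMatchingSet
  have h1 := h (M.filter fun e => ∃ v ∈ e, v ∈ S) (hM.subset (Finset.filter_subset _ _))
    (by simp)
  have h2 : (M.filter fun e => ¬ ∃ v ∈ e, v ∈ S).card ≤ (G.isolate S).matchingNumber := by
    refine IsMatchingSet.card_le ((hM.subset (Finset.filter_subset _ _)).mono fun e he => ?_)
    rw [Finset.mem_filter] at he
    have he1 := hM.1 e he.1
    induction e with | h a b
    push Not at he
    exact ⟨he1, he.2 a (Sym2.mem_mk_left _ _), he.2 b (Sym2.mem_mk_right _ _)⟩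
  have h3 := Finset.card_filter_add_card_filter_not (s := M) (fun e => ∃ v ∈ e, v ∈ S)
  omega

lemma matchingNumber_le_isolate_add_card (K : Finset V) :
    G.matchingNumber ≤ (G.isolate K).matchingNumber + K.card := by
  refine matchingNumber_le_isolate_add_of_filter _ _ fun M hM h => ?_
  refine Finset.card_le_card_of_forall_subsingleton (fun e v => v ∈ e) (fun e he => ?_) ?_
  · obtain ⟨v, hv, hvK⟩ := h e he
    exact ⟨v, hvK, hv⟩
  · exact fun v _ e he f hf => hM.2 e he.1 f hf.1 v he.2 hf.2

/-- No edge leaves `K`, so matching edges that meet `K` lie inside it and use two of its vertices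
each. -/
lemma matchingNumber_le_isolate_add_of_closed (K : Finset V) {l : ℕ} (hl : K.card ≤ 2 * l + 1)
    (h : ∀ a b, G.Adj a b → a ∈ K → b ∈ K) :
    G.matchingNumber ≤ (G.isolate K).matchingNumber + l := by
  classical
  refine matchingNumber_le_isolate_add_of_filter _ _ fun M hM hMK => ?_
  have h1 : (M.biUnion Sym2.toFinset).card = ∑ e ∈ M, 2 := by
    rw [Finset.card_biUnion]
    · refine Finset.sum_congr rfl fun e he => ?_
      exact Sym2.card_toFinset_of_not_isDiag e (G.not_isDiag_of_mem_edgeSet (hM.1 e he))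
    · intro e he f hf hef
      refine Finset.disjoint_left.2 fun v hve hvf => ?_
      exact hef (hM.2 e he f hf v (Sym2.mem_toFinset.1 hve) (Sym2.mem_toFinset.1 hvf))
  have h2 : M.biUnion Sym2.toFinset ⊆ K := by
    intro v hv
    obtain ⟨e, he, hve⟩ := Finset.mem_biUnion.1 hv
    rw [Sym2.mem_toFinset] at hve
    obtain ⟨w, rfl⟩ := Sym2.mem_iff_exists.1 hve
    obtain ⟨x, hx, hxK⟩ := hMK _ he
    rcases Sym2.mem_iff.1 hx with rfl | rfl
    · exact hxK
    · exact h _ _ (hM.1 _ he : G.Adj v x).symm hxK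
  have h3 := Finset.card_le_card h2
  rw [h1, Finset.sum_const, smul_eq_mul] at h3
  omega

lemma IsMatchingSet.card_add_isolate_le {M : Finset (Sym2 V)} (hM : G.IsMatchingSet M)
    {S : Set V} (h : ∀ e ∈ M, ∀ v ∈ e, v ∈ S) :
    (G.isolate S).matchingNumber + M.card ≤ G.matchingNumber := by
  classical
  obtain ⟨N, hN, hk⟩ := (G.isolate S).exists_isMatchingSet
  have hNS : ∀ e ∈ N, ∀ v ∈ e, v ∉ S := by
    intro e he v hv
    obtain ⟨w, rfl⟩ := Sym2.mem_iff_exists.1 hv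
    exact (hN.1 _ he : (G.isolate S).Adj v w).2.1
  have hdisj : Disjoint N M := by
    rw [Finset.disjoint_left]
    intro e he he'
    induction e with | h a b
    exact hNS _ he a (Sym2.mem_mk_left _ _) (h _ he' a (Sym2.mem_mk_left _ _))
  rw [← hk, ← Finset.card_union_of_disjoint hdisj]
  refine IsMatchingSet.card_le ⟨fun e he => ?_, fun e he f hf v hve hvf => ?_⟩
  · rcases Finset.mem_union.1 he with he | he
    · exact edgeSet_mono (isolate_le S) (hN.1 e he)
    · exact hM.1 e he
  · rcases Finset.mem_union.1 he with he | he <;> rcases Finset.mem_union.1 hf with hf | hf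
    · exact hN.2 e he f hf v hve hvf
    · exact absurd (h f hf v hvf) (hNS e he v hve)
    · exact absurd (h e he v hve) (hNS f hf v hvf)
    · exact hM.2 e he f hf v hve hvf

lemma matchingNumber_isolate_add_one_le {x y : V} (h : G.Adj x y) {S : Set V} (hx : x ∈ S)
    (hy : y ∈ S) : (G.isolate S).matchingNumber + 1 ≤ G.matchingNumber := by
  have : G.IsMatchingSet {s(x, y)} := ⟨by simpa using h, by simp⟩
  refine this.card_add_isolate_le fun e he v hv => ?_
  rw [Finset.mem_singleton.1 he, Sym2.mem_iff] at hv
  rcases hv with rfl | rfl <;> assumption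

/-- Every other edge of a path on `2 * l` vertices gives `l` disjoint edges inside `S`; only these
edges are required to be present. -/
lemma matchingNumber_isolate_add_le_of_path (u : ℕ → V) (l : ℕ)
    (hinj : Set.InjOn u (Set.Iio (2 * l))) (hadj : ∀ i < l, G.Adj (u (2 * i)) (u (2 * i + 1)))
    {S : Set V} (hS : ∀ i < 2 * l, u i ∈ S) :
    (G.isolate S).matchingNumber + l ≤ G.matchingNumber := by
  classical
  have key : ∀ i < l, ∀ j < l, ∀ v, v ∈ s(u (2 * i), u (2 * i + 1)) →
      v ∈ s(u (2 * j), u (2 * j + 1)) → i = j := by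
    intro i hi j hj v hvi hvj
    rw [Sym2.mem_iff] at hvi hvj
    have h0 : ∀ a b, a < 2 * l → b < 2 * l → u a = u b → a = b := fun a b ha hb hab =>
      hinj ha hb hab
    rcases hvi with rfl | rfl <;> rcases hvj with h | h <;>
      have := h0 _ _ (by omega) (by omega) h <;> omega
  have hcard : ((Finset.range l).image fun i => s(u (2 * i), u (2 * i + 1))).card = l := by
    rw [Finset.card_image_of_injOn, Finset.card_range]
    intro i hi j hj hij
    simp only at hij
    exact key i (by simpa using hi) j (by simpa using hj) (u (2 * i)) (Sym2.mem_mk_left _ _)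
      (hij ▸ Sym2.mem_mk_left _ _)
  have hM : G.IsMatchingSet ((Finset.range l).image fun i => s(u (2 * i), u (2 * i + 1))) := by
    refine ⟨fun e he => ?_, fun e he f hf v hve hvf => ?_⟩
    · obtain ⟨i, hi, rfl⟩ := Finset.mem_image.1 he
      exact hadj i (by simpa using hi)
    · obtain ⟨i, hi, rfl⟩ := Finset.mem_image.1 he
      obtain ⟨j, hj, rfl⟩ := Finset.mem_image.1 hf
      rw [key i (by simpa using hi) j (by simpa using hj) v hve hvf]
  have := hM.card_add_isolate_le (S := S) fun e he v hv => ?_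
  · rwa [hcard] at this
  · obtain ⟨i, hi, rfl⟩ := Finset.mem_image.1 he
    have hi' : i < l := by simpa using hi
    rcases Sym2.mem_iff.1 hv with rfl | rfl <;> exact hS _ (by omega)

/-! ### Acyclic graphs -/

/-- The leaf is an end of a longest path: a neighbour off the path would extend it, and a neighbour
on the path is the second vertex by acyclicity. -/
lemma IsAcyclic.exists_leaf (hG : G.IsAcyclic) (hne : G ≠ ⊥) :
    ∃ x y, G.Adj x y ∧ ∀ z, G.Adj x z → z = y := by
  classical
  obtain ⟨a, b, hab⟩ := ne_bot_iff_exists_adj.1 hne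
  have : Nonempty V := ⟨a⟩
  obtain ⟨x, v, p, hp, hmax⟩ := Walk.exists_isPath_forall_isPath_length_le_length G
  have hnil : ¬ p.Nil := by
    intro h
    have := hmax _ _ hab.toWalk hab.isPath_toWalk
    rw [Walk.length_eq_zero_iff.2 h] at this
    simp at this
  refine ⟨x, p.snd, p.adj_snd hnil, fun z hz => hG.eq_snd_of_adj_start hp hz ?_⟩
  by_contra hzp
  have := hmax _ _ (Walk.cons hz.symm p) (hp.cons hzp)
  simp at this

/-- **König's theorem** for forests. -/
lemma IsAcyclic.exists_cover (hG : G.IsAcyclic) :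
    ∃ K : Finset V, (∀ a b, G.Adj a b → a ∈ K ∨ b ∈ K) ∧ K.card ≤ G.matchingNumber := by
  classical
  induction G using WellFoundedLT.induction with | ind G ih
  by_cases hne : G = ⊥
  · subst hne
    exact ⟨∅, by simp, by simp⟩
  -- The neighbour `y` of a leaf `x` goes into the cover. Isolating `y` also isolates `x`, so the
  -- edge between them can be added to any matching of what remains.
  obtain ⟨x, y, hxy, hx⟩ := hG.exists_leaf hne
  obtain ⟨K, hK, hKc⟩ := ih (G.isolate {y}) (isolate_lt hxy.symm rfl)
    (hG.anti (isolate_le _))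
  refine ⟨insert y K, fun a b hab => ?_, ?_⟩
  · by_cases ha : a = y
    · simp [ha]
    by_cases hb : b = y
    · simp [hb]
    rcases hK a b ⟨hab, ha, hb⟩ with h | h <;> simp [h]
  · have h1 : (G.isolate {x, y}).matchingNumber + 1 ≤ G.matchingNumber :=
      matchingNumber_isolate_add_one_le hxy (by simp) (by simp)
    have h2 : G.isolate {y} ≤ G.isolate {x, y} := by
      rintro a b ⟨hab, ha, hb⟩
      refine ⟨hab, ?_, ?_⟩
      · rintro (rfl | h)
        · exact hb (hx _ hab)
        · exact ha h
      · rintro (rfl | h)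
        · exact ha (hx _ hab.symm)
        · exact hb h
    have h3 := matchingNumber_mono h2
    have h4 := Finset.card_insert_le y K
    omega

end Finite

end SimpleGraph

/-! ### Inertia of weighted graphs: the upper bound and elimination of vertices. -/

namespace SimpleGraph

open Matrix

variable {V : Type*} {G H : SimpleGraph V}

open Classical in
/-- The matrix with the entries of `B` on the edges of `H` and zero elsewhere. -/
noncomputable def weightMatrix (H : SimpleGraph V) (B : Matrix V V ℂ) : Matrix V V ℂ :=
  Matrix.of fun u v => if H.Adj u v then B u v else 0

/-- A Hermitian matrix whose entries all have modulus one. -/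
def IsUnitWeight (B : Matrix V V ℂ) : Prop :=
  B.IsHermitian ∧ ∀ u v, B u v * B v u = 1

lemma IsUnitWeight.ne_zero {B : Matrix V V ℂ} (hB : IsUnitWeight B) (u v : V) : B u v ≠ 0 := by
  intro h
  have := hB.2 u v
  rw [h, zero_mul] at this
  exact zero_ne_one this

lemma weightMatrix_of_adj {B : Matrix V V ℂ} {u v : V} (h : H.Adj u v) :
    H.weightMatrix B u v = B u v := by simp [weightMatrix, h]

lemma weightMatrix_of_not_adj {B : Matrix V V ℂ} {u v : V} (h : ¬ H.Adj u v) :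
    H.weightMatrix B u v = 0 := by simp [weightMatrix, h]

lemma isHermitian_weightMatrix {B : Matrix V V ℂ} (hB : B.IsHermitian) :
    (H.weightMatrix B).IsHermitian := by
  ext u v
  rw [conjTranspose_apply]
  by_cases h : H.Adj u v
  · rw [weightMatrix_of_adj h, weightMatrix_of_adj h.symm, hB.apply]
  · rw [weightMatrix_of_not_adj h, weightMatrix_of_not_adj (fun h' => h h'.symm), star_zero]

/-- The negative inertia index of `H` with edges weighted by `B`. -/
noncomputable def negIndex [Fintype V] (H : SimpleGraph V) (B : Matrix V V ℂ) : ℕ :=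
  (H.weightMatrix B).negIndex

variable [Fintype V] {B : Matrix V V ℂ}

omit [Fintype V] in
lemma weightMatrix_isolate_singleton (v : V) :
    (H.isolate {v}).weightMatrix B = (H.weightMatrix B).zeroAt v := by
  ext i j
  by_cases hv : i = v ∨ j = v
  · rw [weightMatrix_of_not_adj (H := H.isolate {v}) fun h => hv.elim h.2.1 h.2.2]
    simp [zeroAt, hv]
  · have hz : (H.weightMatrix B).zeroAt v i j = H.weightMatrix B i j := by simp [zeroAt, hv]
    rw [hz]
    push Not at hv
    by_cases h : H.Adj i j
    · rw [weightMatrix_of_adj h, weightMatrix_of_adj (H := H.isolate {v}) ⟨h, hv.1, hv.2⟩]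
    · rw [weightMatrix_of_not_adj h, weightMatrix_of_not_adj (H := H.isolate {v}) fun h1 => h h1.1]

lemma negIndex_le_isolate_singleton_add_one (H : SimpleGraph V) (v : V) :
    H.negIndex B ≤ (H.isolate {v}).negIndex B + 1 := by
  unfold negIndex
  rw [weightMatrix_isolate_singleton]
  exact negIndex_le_zeroAt_add_one _ v

omit [Fintype V] in
lemma isolate_empty : H.isolate ∅ = H := by ext; simp

lemma negIndex_le_isolate_add_card (H : SimpleGraph V) (K : Finset V) :
    H.negIndex B ≤ (H.isolate K).negIndex B + K.card := by
  classical
  induction K using Finset.induction_on with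
  | empty => simp [isolate_empty]
  | insert v K hv ih =>
    have h1 := negIndex_le_isolate_singleton_add_one (B := B) (H.isolate K) v
    rw [isolate_isolate] at h1
    rw [Finset.coe_insert, ← Set.union_singleton, Finset.card_insert_of_notMem hv]
    omega

lemma negIndex_isolate_add_one_le_of_pendant (hB : IsUnitWeight B) {x y : V} (hxy : H.Adj x y)
    (h : ∀ z, H.Adj x z → z = y) : (H.isolate {y}).negIndex B + 1 ≤ H.negIndex B := by
  unfold negIndex
  rw [weightMatrix_isolate_singleton]
  refine negIndex_zeroAt_add_one_le_of_pendant (isHermitian_weightMatrix hB.1) hxy.ne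
    (fun j hj => weightMatrix_of_not_adj fun hadj => hj (h j hadj))
    (weightMatrix_of_not_adj (H.loopless.irrefl y)) ?_
  rw [weightMatrix_of_adj hxy]
  exact hB.ne_zero x y

lemma negIndex_bot : (⊥ : SimpleGraph V).negIndex B = 0 := by
  have h0 : (⊥ : SimpleGraph V).weightMatrix B = 0 := by
    ext i j
    exact weightMatrix_of_not_adj (by simp)
  obtain ⟨U, hU, hk⟩ := ((⊥ : SimpleGraph V).weightMatrix B).exists_isNegOn
  unfold negIndex
  rw [← hk, Submodule.finrank_eq_zero, Submodule.eq_bot_iff]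
  intro z hz
  by_contra hz0
  have := hU z hz hz0
  rw [h0] at this
  simp [hermForm] at this

lemma negIndex_le_of_cover (K : Finset V) (hK : ∀ a b, H.Adj a b → a ∈ K ∨ b ∈ K) :
    H.negIndex B ≤ K.card := by
  have h1 := negIndex_le_isolate_add_card (B := B) H K
  have h2 : H.isolate K = ⊥ := by
    ext a b
    simp only [isolate_adj, Finset.mem_coe, bot_adj, iff_false]
    rintro ⟨hab, ha, hb⟩
    exact (hK a b hab).elim ha hb
  rw [h2, negIndex_bot] at h1
  omega

lemma negIndex_le_matchingNumber_of_isAcyclic (hH : H.IsAcyclic) :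
    H.negIndex B ≤ H.matchingNumber := by
  obtain ⟨K, hK, hc⟩ := hH.exists_cover
  exact (negIndex_le_of_cover K hK).trans hc

omit [Fintype V] in
lemma exists_isCycle_of_not_isAcyclic (h : ¬ G.IsAcyclic) :
    ∃ (u : V) (p : G.Walk u u), p.IsCycle := by
  unfold IsAcyclic at h
  push Not at h
  exact h

/-- The negative inertia index is at most the matching number plus the cyclomatic number. -/
theorem negIndex_le_matchingNumber_add_cyclomaticNumber (G : SimpleGraph V) :
    (G.negIndex B : ℤ) ≤ G.matchingNumber + G.cyclomaticNumber := by
  induction G using WellFoundedLT.induction with | ind G ih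
  by_cases hG : G.IsAcyclic
  · have h1 := negIndex_le_matchingNumber_of_isAcyclic (B := B) hG
    have h2 := cyclomaticNumber_nonneg (G := G)
    omega
  -- Isolating a vertex of a cycle costs at most one in inertia and at least one in the cyclomatic
  -- number, and does not raise the matching number.
  · obtain ⟨u, p, hp⟩ := exists_isCycle_of_not_isAcyclic hG
    have h1 := ih (G.isolate {u}) (isolate_lt (p.adj_snd hp.not_nil) rfl)
    have h2 := negIndex_le_isolate_singleton_add_one (B := B) G u
    have h3 := cyclomaticNumber_isolate_add_one_le hp p.start_mem_support
      (Set.mem_singleton u)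
    have h4 := matchingNumber_mono (isolate_le (G := G) {u})
    omega

/-- A vertex whose isolation lowers the cyclomatic number by two lowers the inertia by at most one,
so the upper bound for the remaining graph is violated. -/
lemma cyclesDisjoint_of_le_negIndex
    (h : (G.matchingNumber : ℤ) + G.cyclomaticNumber ≤ G.negIndex B) : G.CyclesDisjoint := by
  by_contra hG
  obtain ⟨x, hx⟩ := exists_cyclomaticNumber_isolate_add_two_le hG
  have h1 := negIndex_le_matchingNumber_add_cyclomaticNumber (B := B) (G.isolate {x})
  have h2 := negIndex_le_isolate_singleton_add_one (B := B) G x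
  have h3 := matchingNumber_mono (isolate_le (G := G) {x})
  omega

/-- Elimination of a set `K` of vertices matched by `π` into vertices all of whose neighbours
lie in `K`. -/
lemma card_add_negIndex_isolate_le (hB : IsUnitWeight B) (K : Finset V) (π : V → V) :
    ∀ H : SimpleGraph V, Set.InjOn π K → (∀ y ∈ K, π y ∉ K) → (∀ y ∈ K, H.Adj (π y) y) →
    (∀ y ∈ K, ∀ z, H.Adj (π y) z → z ∈ K) →
    (H.isolate ((K : Set V) ∪ π '' K)ᶜ).IsAcyclic →
    K.card + (H.isolate K).negIndex B ≤ H.negIndex B := by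
  classical
  induction hn : K.card generalizing K with
  | zero =>
    intro H _ _ _ _ _
    rw [Finset.card_eq_zero.1 hn]
    simp [isolate_empty]
  | succ n ih =>
    intro H hinj hπ hadj hnbr hac
    have herase : ∀ y ∈ K, ((K.erase y : Finset V) : Set V) ∪ {y} = K := fun y hy => by
      rw [← Finset.coe_singleton, ← Finset.coe_union, Finset.erase_union_of_mem]
      · simp [hy]
      · simp
    have hFadj : ∀ y ∈ K, ∀ z ∈ K, H.Adj (π y) z →
        (H.isolate ((K : Set V) ∪ π '' K)ᶜ).Adj (π y) z := by
      intro y hy z hz h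
      simp only [isolate_adj, Set.mem_compl_iff, Set.mem_union, Finset.mem_coe, not_not]
      exact ⟨h, Or.inr ⟨y, hy, rfl⟩, Or.inl hz⟩
    have hacle : ∀ (H' : SimpleGraph V) (y : V), H' ≤ H →
        (H'.isolate (((K.erase y : Finset V) : Set V) ∪ π '' (K.erase y : Finset V))ᶜ).IsAcyclic := by
      intro H' y hle
      refine hac.anti (isolate_mono hle ?_)
      rw [Set.compl_subset_compl]
      have : ((K.erase y : Finset V) : Set V) ⊆ K := by simp
      exact Set.union_subset_union this (Set.image_mono this)
    have hKne : K.Nonempty := Finset.card_pos.1 (by omega)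
    obtain ⟨y₀, hy₀⟩ := hKne
    obtain ⟨a, b, hab, ha⟩ := hac.exists_leaf
      (ne_bot_iff_exists_adj.2 ⟨_, _, hFadj y₀ hy₀ y₀ hy₀ (hadj y₀ hy₀)⟩)
    have haK := hab.2.1
    rw [Set.mem_compl_iff, not_not] at haK
    rcases haK with haK | ⟨y, hy, rfl⟩
    -- A leaf `a` in `K` is adjacent to no other `π y`, so the rest of `K` can be eliminated first.
    -- After that `π a` is pendant at `a`.
    · have hπa : π a = b := ha _ (hFadj a haK a haK (hadj a haK)).symm
      have hcard : (K.erase a).card = n := by rw [Finset.card_erase_of_mem haK]; omega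
      have hle := ih (K.erase a) hcard H (hinj.mono (by simp))
        (fun y hy h => hπ y (Finset.mem_of_mem_erase hy) (Finset.mem_of_mem_erase h))
        (fun y hy => hadj y (Finset.mem_of_mem_erase hy))
        (fun y hy z hz => by
          have hyK := Finset.mem_of_mem_erase hy
          have hzK := hnbr y hyK z hz
          refine Finset.mem_erase.2 ⟨?_, hzK⟩
          rintro rfl
          have h1 := ha _ (hFadj y hyK z haK hz).symm
          exact Finset.ne_of_mem_erase hy (hinj hyK haK (h1.trans hπa.symm)))
        (hacle H a le_rfl)
      have hpend := negIndex_isolate_add_one_le_of_pendant (H := H.isolate (K.erase a : Finset V))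
        hB (x := π a) (y := a)
        ⟨hadj a haK, fun h => hπ a haK (Finset.mem_of_mem_erase h), by simp⟩
        (fun z hz => by
          have h1 := hnbr a haK z hz.1
          by_contra hza
          exact hz.2.2 (by simp [hza, h1]))
      rw [isolate_isolate, herase a haK] at hpend
      omega
    -- A leaf `π y` is pendant in `H` itself, since all its neighbours in `H` lie in `K`. So `y` is
    -- eliminated first.
    · have hyK : y ∈ K := hy
      have hb : y = b := ha _ (hFadj y hyK y hyK (hadj y hyK))
      have hpend := negIndex_isolate_add_one_le_of_pendant (H := H) hB (hadj y hyK)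
        (fun z hz => (ha _ (hFadj y hyK z (hnbr y hyK z hz) hz)).trans hb.symm)
      have hcard : (K.erase y).card = n := by rw [Finset.card_erase_of_mem hyK]; omega
      have hle := ih (K.erase y) hcard (H.isolate {y}) (hinj.mono (by simp))
        (fun z hz h => hπ z (Finset.mem_of_mem_erase hz) (Finset.mem_of_mem_erase h))
        (fun z hz => ⟨hadj z (Finset.mem_of_mem_erase hz),
          fun h => hπ z (Finset.mem_of_mem_erase hz) (by rw [Set.mem_singleton_iff.1 h]; exact hyK),
          Finset.ne_of_mem_erase hz⟩)
        (fun z hz t ht => Finset.mem_erase.2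
          ⟨ht.2.2, hnbr z (Finset.mem_of_mem_erase hz) t ht.1⟩)
        (hacle _ y (isolate_le _))
      rw [isolate_isolate, Set.union_comm, herase y hyK] at hle
      omega

end SimpleGraph

/-! ### The inertia of an isolated odd cycle. -/

namespace SimpleGraph

open Matrix

variable {V : Type*} {G H : SimpleGraph V} {k l : ℕ} {u : ℕ → V}

/-- The vertices `u 0, …, u (k - 1)` are distinct and form a cycle of `H`. -/
structure IsCycleSeq (H : SimpleGraph V) (k : ℕ) (u : ℕ → V) : Prop where
  three_le : 3 ≤ k
  wrap : u k = u 0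
  inj : ∀ i < k, ∀ j < k, u i = u j → i = j
  adj : ∀ i < k, H.Adj (u i) (u (i + 1))

/-- No edge of `H` other than those of the cycle `u` meets the vertices `u 0, …, u (k - 1)`. -/
structure IsClosedSeq (H : SimpleGraph V) (k : ℕ) (u : ℕ → V) : Prop where
  succ : ∀ i, i + 1 < k → ∀ z, H.Adj (u (i + 1)) z → z = u i ∨ z = u (i + 2)
  zero : ∀ z, H.Adj (u 0) z → z = u 1 ∨ z = u (k - 1)

/-- The set of the vertices of a cycle. -/
def seqVerts (k : ℕ) (u : ℕ → V) : Set V := {v | ∃ i < k, u i = v}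

lemma IsCycleSeq.mem_seqVerts (hu : H.IsCycleSeq k u) {i : ℕ} (hi : i ≤ k) :
    u i ∈ seqVerts k u := by
  rcases hi.lt_or_eq with h | rfl
  · exact ⟨i, h, rfl⟩
  · exact ⟨0, by have := hu.three_le; omega, hu.wrap.symm⟩

/-- The gain of the first `i` steps. -/
noncomputable def seqGain (B : Matrix V V ℂ) (u : ℕ → V) (i : ℕ) : ℂ :=
  ∏ j ∈ Finset.range i, B (u j) (u (j + 1))

lemma star_seqGain_succ {B : Matrix V V ℂ} (hB : IsUnitWeight B) (u : ℕ → V) (i : ℕ) :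
    star (seqGain B u (i + 1)) = star (seqGain B u i) * B (u (i + 1)) (u i) := by
  rw [seqGain, Finset.prod_range_succ, star_mul', hB.1.apply]
  rfl

lemma seqGain_mul_star {B : Matrix V V ℂ} (hB : IsUnitWeight B) (u : ℕ → V) (i : ℕ) :
    seqGain B u i * star (seqGain B u i) = 1 := by
  induction i with
  | zero => simp [seqGain]
  | succ i ih =>
    rw [star_seqGain_succ hB, seqGain, Finset.prod_range_succ]
    calc _ = (seqGain B u i * star (seqGain B u i)) * (B (u i) (u (i + 1)) * B (u (i + 1)) (u i)) := by
          rw [seqGain]; ring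
      _ = 1 := by rw [ih, hB.2, mul_one]

/-- The sign pattern of the vector which is annihilated by all rows but one of an odd cycle. -/
noncomputable def seqSign (l : ℕ) (φ : ℂ) (i : ℕ) : ℂ :=
  if Even i then (-1) ^ (i / 2) else (-1) ^ (l + i / 2) * φ

lemma seqSign_add_two (l : ℕ) (φ : ℂ) (i : ℕ) : seqSign l φ (i + 2) = -seqSign l φ i := by
  unfold seqSign
  rw [show (i + 2) / 2 = i / 2 + 1 by omega]
  by_cases h : Even i
  · have h2 : Even (i + 2) := by simpa [Nat.even_add] using h
    rw [if_pos h, if_pos h2, pow_succ]; ring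
  · have h2 : ¬ Even (i + 2) := by simpa [Nat.even_add] using h
    rw [if_neg h, if_neg h2, ← add_assoc, pow_succ]; ring

variable [Fintype V] {B : Matrix V V ℂ}

lemma mulVec_eq_of_neighbors {x a b : V} (hab : a ≠ b) (ha : H.Adj x a) (hb : H.Adj x b)
    (h : ∀ z, H.Adj x z → z = a ∨ z = b) (z : V → ℂ) :
    (H.weightMatrix B *ᵥ z) x = B x a * z a + B x b * z b := by
  rw [mulVec, dotProduct, Finset.sum_eq_add a b hab, weightMatrix_of_adj ha,
    weightMatrix_of_adj hb]
  · intro c _ hc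
    rw [weightMatrix_of_not_adj, zero_mul]
    intro hadj
    exact (h c hadj).elim hc.1 hc.2
  · exact fun h => absurd (Finset.mem_univ _) h
  · exact fun h => absurd (Finset.mem_univ _) h

/-- On an isolated odd cycle there is a vector which is annihilated by all rows but one. -/
lemma exists_vector_of_odd_cycle (hB : IsUnitWeight B) (hu : H.IsCycleSeq (2 * l + 1) u)
    (hc : H.IsClosedSeq (2 * l + 1) u) :
    ∃ g : V → ℂ, g (u 0) = 1 ∧ (∀ w, w ≠ u 0 → (H.weightMatrix B *ᵥ g) w = 0) ∧
      (H.weightMatrix B).hermForm g = 2 * ((-1 : ℂ) ^ l * seqGain B u (2 * l + 1)).re := by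
  classical
  have hl : 1 ≤ l := by have := hu.three_le; omega
  set φ := seqGain B u (2 * l + 1) with hφ
  -- The conjugate partial gains gauge the weights along the cycle to one. The row equations then
  -- ask only that entries two steps apart have opposite signs.
  let c : ℕ → ℂ := fun i => seqSign l φ i * star (seqGain B u i)
  have hc0 : c 0 = 1 := by simp [c, seqSign, seqGain]
  -- The entry after a full turn must agree with the one at `u 0`; this dictates the factor `(-1) ^
  -- l * φ` at odd positions.
  have hcl : c (2 * l + 1) = 1 := by
    have h1 : ¬ Even (2 * l + 1) := by simp
    have h2 : l + (2 * l + 1) / 2 = 2 * l := by omega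
    simp only [c, seqSign, if_neg h1, h2, ← hφ]
    rw [mul_assoc, hφ, seqGain_mul_star hB]
    simp
  let g : V → ℂ := fun v => if h : ∃ i, i < 2 * l + 1 ∧ u i = v then c h.choose else 0
  have hg' : ∀ i < 2 * l + 1, g (u i) = c i := by
    intro i hi
    have h : ∃ j, j < 2 * l + 1 ∧ u j = u i := ⟨i, hi, rfl⟩
    simp only [g, dif_pos h]
    rw [hu.inj _ h.choose_spec.1 _ hi h.choose_spec.2]
  have hg : ∀ i ≤ 2 * l + 1, g (u i) = c i := by
    intro i hi
    rcases hi.lt_or_eq with h | rfl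
    · exact hg' i h
    · rw [hu.wrap, hg' 0 (by omega), hc0, hcl]
  have hgout : ∀ v, v ∉ seqVerts (2 * l + 1) u → g v = 0 := fun v hv => dif_neg hv
  have hne : ∀ i, i + 1 < 2 * l + 1 → u i ≠ u (i + 2) := by
    intro i hi h
    by_cases h2 : i + 2 < 2 * l + 1
    · have := hu.inj _ (by omega) _ h2 h
      omega
    · rw [show i + 2 = 2 * l + 1 by omega, hu.wrap] at h
      have := hu.inj _ (by omega) _ (by omega) h
      omega
  have hback : ∀ i, B (u (i + 1)) (u i) * star (seqGain B u i) = star (seqGain B u (i + 1)) :=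
    fun i => by rw [star_seqGain_succ hB, mul_comm]
  have hfwd : ∀ i, B (u i) (u (i + 1)) * star (seqGain B u (i + 1)) = star (seqGain B u i) :=
    fun i => by
      rw [star_seqGain_succ hB, mul_comm (star _), ← mul_assoc, hB.2, one_mul]
  have hrow : ∀ i, i + 1 < 2 * l + 1 → (H.weightMatrix B *ᵥ g) (u (i + 1)) = 0 := by
    intro i hi
    rw [mulVec_eq_of_neighbors (hne i hi) (hu.adj i (by omega)).symm (hu.adj (i + 1) hi)
      (hc.succ i hi), hg i (by omega), hg (i + 2) (by omega)]
    simp only [c, seqSign_add_two]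
    calc _ = seqSign l φ i * (B (u (i + 1)) (u i) * star (seqGain B u i))
          - seqSign l φ i * (B (u (i + 1)) (u (i + 1 + 1)) * star (seqGain B u (i + 1 + 1))) := by
          ring
      _ = 0 := by rw [hback, hfwd, sub_self]
  have hrow' : ∀ w, w ≠ u 0 → (H.weightMatrix B *ᵥ g) w = 0 := by
    intro w hw
    by_cases hwS : w ∈ seqVerts (2 * l + 1) u
    · obtain ⟨i, hi, rfl⟩ := hwS
      obtain ⟨j, rfl⟩ : ∃ j, i = j + 1 :=
        Nat.exists_eq_succ_of_ne_zero (by rintro rfl; exact hw rfl)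
      exact hrow j hi
    · refine Finset.sum_eq_zero fun j _ => ?_
      by_cases hj : H.Adj w j
      · rw [hgout j, mul_zero]
        rintro ⟨i, hi, rfl⟩
        apply hwS
        rcases i with _ | i
        · rcases hc.zero w hj.symm with rfl | rfl
          · exact ⟨1, by omega, rfl⟩
          · exact ⟨_, by omega, rfl⟩
        · rcases hc.succ i hi w hj.symm with rfl | rfl
          · exact ⟨i, by omega, rfl⟩
          · exact hu.mem_seqVerts (by omega)
      · exact mul_eq_zero_of_left (weightMatrix_of_not_adj hj) _
  refine ⟨g, by rw [hg 0 (by omega), hc0], hrow', ?_⟩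
  -- In the row of `u 0` the neighbours `u 1` and `u (2 * l)` contribute a number and its conjugate.
  -- As all other rows vanish and `g (u 0) = 1`, their sum is the value of the form.
  have h0 : (H.weightMatrix B *ᵥ g) (u 0) = (-1) ^ l * φ + (-1) ^ l * star φ := by
    have h2l : u (2 * l + 1 - 1) = u (2 * l) := by rw [Nat.add_sub_cancel]
    have h01 : H.Adj (u 0) (u (2 * l)) := by
      rw [← hu.wrap]; exact (hu.adj (2 * l) (by omega)).symm
    rw [mulVec_eq_of_neighbors (a := u 1) (b := u (2 * l)) (fun h => by
      have := hu.inj _ (by omega) _ (by omega) h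
      omega) (hu.adj 0 (by omega)) h01 (by rw [← h2l]; exact hc.zero),
      hg 1 (by omega), hg (2 * l) (by omega)]
    have e1 : seqSign l φ 1 = (-1) ^ l * φ := by simp [seqSign]
    have e2 : seqSign l φ (2 * l) = (-1) ^ l := by simp [seqSign]
    simp only [c, e1, e2]
    have h3 := hfwd 0
    have h4 := hback (2 * l)
    rw [hu.wrap, ← hφ] at h4
    have h5 : star (seqGain B u 0) = 1 := by simp [seqGain]
    rw [h5, zero_add] at h3
    calc _ = (-1) ^ l * φ * (B (u 0) (u 1) * star (seqGain B u 1))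
          + (-1) ^ l * (B (u 0) (u (2 * l)) * star (seqGain B u (2 * l))) := by ring
      _ = _ := by rw [h3, h4, mul_one]
  have hform : star g ⬝ᵥ H.weightMatrix B *ᵥ g = (-1) ^ l * φ + (-1) ^ l * star φ := by
    rw [dotProduct, Finset.sum_eq_single (u 0) (fun w _ hw => by rw [hrow' w hw, mul_zero])
      (fun h => absurd (Finset.mem_univ _) h), h0]
    simp [hg 0 (by omega), hc0]
  have hsign : ((-1 : ℂ) ^ l) = (((-1 : ℝ) ^ l : ℝ) : ℂ) := by push_cast; rfl
  rw [hermForm, hform, hsign, Complex.add_re, Complex.re_ofReal_mul, Complex.re_ofReal_mul,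
    Complex.star_def, Complex.conj_re]
  ring

omit [Fintype V] in
/-- Isolating every other vertex of a cycle isolates all its vertices. -/
lemma isolate_even_eq (hc : H.IsClosedSeq (2 * l + 1) u) :
    H.isolate {v | ∃ i ≤ l, u (2 * i) = v} = H.isolate (seqVerts (2 * l + 1) u) := by
  have key : ∀ a b, H.Adj a b → a ∉ {v | ∃ i ≤ l, u (2 * i) = v} →
      b ∉ {v | ∃ i ≤ l, u (2 * i) = v} → a ∉ seqVerts (2 * l + 1) u := by
    rintro a b hab ha hb ⟨i, hi, rfl⟩
    obtain ⟨j, rfl | rfl⟩ := Nat.even_or_odd' i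
    · exact ha ⟨j, by omega, rfl⟩
    · rcases hc.succ (2 * j) hi b hab with rfl | rfl
      · exact hb ⟨j, by omega, rfl⟩
      · exact hb ⟨j + 1, by omega, rfl⟩
  ext a b
  constructor
  · rintro ⟨hab, ha, hb⟩
    exact ⟨hab, key a b hab ha hb, key b a hab.symm hb ha⟩
  · rintro ⟨hab, ha, hb⟩
    exact ⟨hab, fun ⟨i, hi, h⟩ => ha ⟨2 * i, by omega, h⟩,
      fun ⟨i, hi, h⟩ => hb ⟨2 * i, by omega, h⟩⟩

/-- Type D makes the vector of `exists_vector_of_odd_cycle` negative, so `u 0` accounts for one. The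
path that remains accounts for `l` more by `l` pendant eliminations. -/
lemma add_le_negIndex_of_typeD (hB : IsUnitWeight B) (hu : H.IsCycleSeq (2 * l + 1) u)
    (hc : H.IsClosedSeq (2 * l + 1) u)
    (hD : ((-1 : ℂ) ^ l * seqGain B u (2 * l + 1)).re < 0) :
    (H.isolate (seqVerts (2 * l + 1) u)).negIndex B + (l + 1) ≤ H.negIndex B := by
  have h1 : (H.isolate {u 0}).negIndex B + 1 ≤ H.negIndex B := by
    obtain ⟨g, -, hg, hform⟩ := exists_vector_of_odd_cycle hB hu hc
    unfold negIndex
    rw [weightMatrix_isolate_singleton]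
    exact negIndex_zeroAt_add_one_le (isHermitian_weightMatrix hB.1) _ g hg (by rw [hform]; linarith)
  have h2 : ∀ j ≤ l, (H.isolate {v | ∃ i ≤ j, u (2 * i) = v}).negIndex B + j
      ≤ (H.isolate {u 0}).negIndex B := by
    intro j hj
    induction j with
    | zero =>
      have : {v | ∃ i ≤ 0, u (2 * i) = v} = {u 0} := by
        ext v
        simp [eq_comm]
      rw [this, add_zero]
    | succ j ih =>
      have hS : {v | ∃ i ≤ j + 1, u (2 * i) = v}
          = {v | ∃ i ≤ j, u (2 * i) = v} ∪ {u (2 * j + 2)} := by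
        ext v
        simp only [Set.mem_ofPred_eq, Set.mem_union, Set.mem_singleton_iff]
        constructor
        · rintro ⟨i, hi, rfl⟩
          rcases Nat.le_succ_iff.1 hi with h | rfl
          · exact Or.inl ⟨i, h, rfl⟩
          · exact Or.inr rfl
        · rintro (⟨i, hi, rfl⟩ | rfl)
          · exact ⟨i, by omega, rfl⟩
          · exact ⟨j + 1, le_rfl, rfl⟩
      -- With `u 0, u 2, …, u (2 * j)` isolated, `u (2 * j + 1)` has the single neighbour `u (2 * j
      -- + 2)`.
      have := negIndex_isolate_add_one_le_of_pendant
        (H := H.isolate {v | ∃ i ≤ j, u (2 * i) = v}) hB (x := u (2 * j + 1)) (y := u (2 * j + 2))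
        ⟨hu.adj _ (by omega), fun ⟨i, hi, h⟩ => by
            have := hu.inj _ (by omega) _ (by omega) h
            omega, fun ⟨i, hi, h⟩ => by
            have := hu.inj _ (by omega) _ (by omega) h
            omega⟩
        (fun z hz => by
          rcases hc.succ (2 * j) (by omega) z hz.1 with rfl | rfl
          · exact absurd ⟨j, le_rfl, rfl⟩ hz.2.2
          · rfl)
      rw [isolate_isolate, ← hS] at this
      have := ih (by omega)
      omega
  have h3 := h2 l le_rfl
  rw [isolate_even_eq hc] at h3
  omega

/-- Here the same vector is nonnegative, so isolating `u 0` loses nothing. The remaining path is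
covered by the `l` vertices `u 2, u 4, …, u (2 * l)`, which cost at most one each. -/
lemma negIndex_le_of_not_typeD (hB : IsUnitWeight B) (hu : H.IsCycleSeq (2 * l + 1) u)
    (hc : H.IsClosedSeq (2 * l + 1) u)
    (hD : 0 ≤ ((-1 : ℂ) ^ l * seqGain B u (2 * l + 1)).re) :
    H.negIndex B ≤ (H.isolate (seqVerts (2 * l + 1) u)).negIndex B + l := by
  classical
  have h1 : H.negIndex B ≤ (H.isolate {u 0}).negIndex B := by
    obtain ⟨g, hg0, hg, hform⟩ := exists_vector_of_odd_cycle hB hu hc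
    unfold negIndex
    rw [weightMatrix_isolate_singleton]
    exact negIndex_le_zeroAt (isHermitian_weightMatrix hB.1) _ g hg0 hg (by rw [hform]; linarith)
  have h2 := negIndex_le_isolate_add_card (B := B) (H.isolate {u 0})
    ((Finset.range l).image fun i => u (2 * i + 2))
  have h3 : ((Finset.range l).image fun i => u (2 * i + 2)).card ≤ l := by
    simpa using Finset.card_image_le (s := Finset.range l) (f := fun i => u (2 * i + 2))
  have h4 : ({u 0} : Set V) ∪ ((Finset.range l).image fun i => u (2 * i + 2) : Finset V)
      = {v | ∃ i ≤ l, u (2 * i) = v} := by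
    ext v
    simp only [Finset.coe_image, Finset.coe_range, Set.mem_union, Set.mem_singleton_iff,
      Set.mem_image, Set.mem_Iio, Set.mem_ofPred_eq]
    constructor
    · rintro (rfl | ⟨i, hi, rfl⟩)
      · exact ⟨0, by omega, rfl⟩
      · exact ⟨i + 1, by omega, rfl⟩
    · rintro ⟨i, hi, rfl⟩
      rcases i with _ | i
      · exact Or.inl rfl
      · exact Or.inr ⟨i, by omega, rfl⟩
  rw [isolate_isolate, h4, isolate_even_eq hc] at h2
  omega

/-- The numerical condition of Type D for a cycle given by its sequence of vertices. -/
def IsTypeDSeq (B : Matrix V V ℂ) (k : ℕ) (u : ℕ → V) : Prop :=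
  Odd k ∧ ((-1 : ℂ) ^ ((k - 1) / 2) * seqGain B u k).re < 0

end SimpleGraph

/-! ### Graphs with disjoint cycles, and attainment of the bound from a cover of the bridges. -/

namespace SimpleGraph

open Matrix

variable {V : Type*} {G H : SimpleGraph V}

/-! ### Cycles as sequences of vertices -/

lemma Walk.IsCycle.isCycleSeq {u : V} {p : G.Walk u u} (hp : p.IsCycle)
    (h : ∀ e ∈ p.edges, e ∈ H.edgeSet) : H.IsCycleSeq p.length p.getVert where
  three_le := hp.three_le_length
  wrap := by simp
  inj i hi j hj hij := hp.getVert_injOn' (by simp; omega) (by simp; omega) hij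
  adj i hi := by
    refine H.mem_edgeSet.1 (h _ ?_)
    rw [← Walk.adj_toSubgraph_iff_mem_edges]
    exact p.toSubgraph_adj_getVert hi

lemma Walk.IsCycle.seqVerts_eq {u : V} {p : G.Walk u u} (hp : p.IsCycle) :
    seqVerts p.length p.getVert = {x | x ∈ p.support} := by
  ext x
  constructor
  · rintro ⟨i, -, rfl⟩
    exact p.getVert_mem_support i
  · intro hx
    obtain ⟨i, rfl, hi⟩ := Walk.mem_support_iff_exists_getVert.1 hx
    exact (hp.isCycleSeq (fun e he => p.edges_subset_edgeSet he)).mem_seqVerts hi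

lemma Walk.IsCycle.isClosedSeq {u : V} {p : G.Walk u u} (hp : p.IsCycle)
    (h : ∀ x ∈ p.support, ∀ z, H.Adj x z → s(x, z) ∈ p.edges) :
    H.IsClosedSeq p.length p.getVert := by
  have hu := hp.isCycleSeq (fun e he => p.edges_subset_edgeSet he)
  have h3 := hu.three_le
  have key : ∀ i < p.length, ∀ z, H.Adj (p.getVert i) z → ∃ j < p.length,
      (p.getVert j = p.getVert i ∧ z = p.getVert (j + 1)) ∨
      (p.getVert (j + 1) = p.getVert i ∧ z = p.getVert j) := by
    intro i hi z hz
    have := h _ (p.getVert_mem_support i) z hz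
    rw [← Walk.adj_toSubgraph_iff_mem_edges, Walk.toSubgraph_adj_iff] at this
    obtain ⟨j, hj, hjl⟩ := this
    rcases Sym2.eq_iff.1 hj with ⟨h1, h2⟩ | ⟨h1, h2⟩
    · exact ⟨j, hjl, Or.inl ⟨h1, h2.symm⟩⟩
    · exact ⟨j, hjl, Or.inr ⟨h2, h1.symm⟩⟩
  constructor
  · intro i hi z hz
    obtain ⟨j, hj, ⟨h1, rfl⟩ | ⟨h1, rfl⟩⟩ := key _ hi z hz
    · rw [hu.inj _ hj _ hi h1]
      exact Or.inr rfl
    · by_cases hjl : j + 1 < p.length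
      · have := hu.inj _ hjl _ hi h1
        rw [show j = i by omega]
        exact Or.inl rfl
      · rw [show j + 1 = p.length by omega, hu.wrap] at h1
        have := hu.inj _ (by omega) _ hi h1
        omega
  · intro z hz
    obtain ⟨j, hj, ⟨h1, rfl⟩ | ⟨h1, rfl⟩⟩ := key 0 (by omega) z hz
    · rw [hu.inj _ hj _ (by omega) h1]
      exact Or.inl rfl
    · by_cases hjl : j + 1 < p.length
      · have := hu.inj _ hjl _ (by omega) h1
        omega
      · rw [show j = p.length - 1 by omega]
        exact Or.inr rfl

/-- An edge that is not a bridge lies on a cycle; this cycle meets `p` at `x` and so has its edges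
in `p`. -/
lemma CyclesDisjoint.mem_edges (hG : G.CyclesDisjoint) {u x z : V} {p : G.Walk u u}
    (hp : p.IsCycle) (hx : x ∈ p.support) (hxz : G.Adj x z) (hb : ¬ G.IsBridge s(x, z)) :
    s(x, z) ∈ p.edges := by
  obtain ⟨v, q, hq, he⟩ := exists_isCycle_of_not_isBridge (G.mem_edgeSet.2 hxz) hb
  exact hG q p hq hp x (q.fst_mem_support_of_mem_edges he) hx _ he

/-- A cycle avoiding `S` is a cycle of the graph with `S` isolated. -/
lemma Walk.IsCycle.not_isBridge_isolate {u : V} {p : G.Walk u u} (hp : p.IsCycle) {S : Set V}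
    (h : ∀ x ∈ p.support, x ∉ S) {e : Sym2 V} (he : e ∈ p.edges) :
    ¬ (G.isolate S).IsBridge e := fun hb =>
  hb.notMem_edges_of_isCycle (hp.transfer (p.edges_subset_of_support_disjoint h))
    (by rwa [Walk.edges_transfer])

/-- All cycles of `G` satisfy the numerical condition of Type D. -/
def AllTypeD (G : SimpleGraph V) (B : Matrix V V ℂ) : Prop :=
  ∀ (u : V) (p : G.Walk u u), p.IsCycle → IsTypeDSeq B p.length p.getVert

lemma AllTypeD.anti {B : Matrix V V ℂ} (hG : G.AllTypeD B) (h : H ≤ G) : H.AllTypeD B := by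
  intro u p hp
  have := hG u (p.mapLe h) ((Walk.isCycle_mapLe h).2 hp)
  have hv : (p.mapLe h).getVert = p.getVert := by
    ext i
    exact p.getVert_map _ i
  rwa [hv, Walk.length_mapLe] at this

section Finite

variable [Finite V]

/-- Deleting one edge of `p` costs one. Any other edge lost in isolating `p` is then a bridge: a
cycle through it would meet `p`, hence contain the deleted edge. -/
lemma CyclesDisjoint.cyclomaticNumber_le (hG : G.CyclesDisjoint) {u : V} {p : G.Walk u u}
    (hp : p.IsCycle) :
    G.cyclomaticNumber ≤ (G.isolate {x | x ∈ p.support}).cyclomaticNumber + 1 := by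
  obtain ⟨y, hy⟩ := hp.exists_mem_edges p.start_mem_support
  have h1 := cyclomaticNumber_deleteEdges_of_not_isBridge (p.edges_subset_edgeSet hy)
    fun hb => hb.notMem_edges_of_isCycle hp hy
  have h2 : (G.deleteEdges {s(u, y)}).cyclomaticNumber
      ≤ (G.isolate {x | x ∈ p.support}).cyclomaticNumber := by
    refine cyclomaticNumber_le_of_isBridge (isolate_le_deleteEdges p.start_mem_support) ?_
    intro f hf hf'
    by_contra hb
    obtain ⟨v, q, hq, hfq⟩ := exists_isCycle_of_not_isBridge hf hb
    have hle := deleteEdges_le (G := G) {s(u, y)}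
    have hmeet : ∃ x ∈ q.support, x ∈ p.support := by
      by_contra! hno
      apply hf'
      have := (q.mapLe hle).edges_subset_of_support_disjoint (S := {x | x ∈ p.support})
        (by simpa using hno) f (by simpa using hfq)
      exact this
    obtain ⟨x, hxq, hxp⟩ := hmeet
    have := hG p (q.mapLe hle) hp ((Walk.isCycle_mapLe hle).2 hq) x hxp (by simpa using hxq) _ hy
    rw [Walk.edges_mapLe_eq_edges] at this
    have := q.edges_subset_edgeSet this
    rw [edgeSet_deleteEdges] at this
    exact this.2 rfl
  omega

lemma matchingNumber_bot : (⊥ : SimpleGraph V).matchingNumber = 0 := by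
  obtain ⟨M, hM, hk⟩ := (⊥ : SimpleGraph V).exists_isMatchingSet
  have := hM.card_le_card_of_cover ∅ (by simp)
  simp at this
  rw [← hk, this, Finset.card_empty]

lemma Walk.IsCycle.matchingNumber_le {u : V} {p : G.Walk u u} (hp : p.IsCycle) {l : ℕ}
    (hl : p.length ≤ 2 * l + 1)
    (hc : ∀ x ∈ p.support, ∀ z, H.Adj x z → s(x, z) ∈ p.edges) :
    H.matchingNumber ≤ (H.isolate {x | x ∈ p.support}).matchingNumber + l := by
  classical
  have hset : {x | x ∈ p.support}
      = ((Finset.range p.length).image p.getVert : Finset V) := by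
    rw [← hp.seqVerts_eq]
    ext x
    simp [seqVerts]
  have hcard : ((Finset.range p.length).image p.getVert).card ≤ 2 * l + 1 := by
    refine Finset.card_image_le.trans ?_
    rwa [Finset.card_range]
  rw [hset]
  refine matchingNumber_le_isolate_add_of_closed _ hcard fun a b hab ha => ?_
  rw [← Finset.mem_coe, ← hset] at ha ⊢
  exact p.snd_mem_support_of_mem_edges (hc a ha b hab)

end Finite

variable [Fintype V] {B : Matrix V V ℂ}

/-- If all edges lie on cycles, which are disjoint and of Type D, the upper bound is attained. -/
lemma le_negIndex_of_forall_not_isBridge (hB : IsUnitWeight B) (H : SimpleGraph V) :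
    (∀ e ∈ H.edgeSet, ¬ H.IsBridge e) → H.CyclesDisjoint → H.AllTypeD B →
    (H.matchingNumber : ℤ) + H.cyclomaticNumber ≤ H.negIndex B := by
  induction H using WellFoundedLT.induction with | ind H ih
  intro hnb hH hD
  by_cases hbot : H = ⊥
  · subst hbot
    rw [matchingNumber_bot, cyclomaticNumber_bot]
    simp
  obtain ⟨a, b, hab⟩ := ne_bot_iff_exists_adj.1 hbot
  obtain ⟨u, p, hp, -⟩ := exists_isCycle_of_not_isBridge (H.mem_edgeSet.2 hab) (hnb _ hab)
  have hcl : ∀ x ∈ p.support, ∀ z, H.Adj x z → s(x, z) ∈ p.edges := fun x hx z hxz =>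
    hH.mem_edges hp hx hxz (hnb _ hxz)
  have hseq := hp.isCycleSeq (fun e he => p.edges_subset_edgeSet he)
  have hcseq := hp.isClosedSeq hcl
  obtain ⟨⟨l, hl⟩, hneg⟩ := hD u p hp
  have h1 := ih (H.isolate {x | x ∈ p.support})
    (isolate_lt (p.adj_snd hp.not_nil) p.start_mem_support)
    (by
      intro e he
      obtain ⟨v, q, hq, heq⟩ := exists_isCycle_of_not_isBridge (edgeSet_mono (isolate_le _) he)
        (hnb e (edgeSet_mono (isolate_le _) he))
      refine hq.not_isBridge_isolate (fun x hxq hxp => ?_) heq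
      have hep := hH q p hq hp x hxq hxp e heq
      induction e with | h c d
      exact he.2.1 (p.fst_mem_support_of_mem_edges hep))
    (hH.anti (isolate_le _)) (hD.anti (isolate_le _))
  -- Isolating the cycle costs the cyclomatic number at most one and the matching number at most
  -- `l`, while the inertia falls by at least `l + 1`.
  have h2 := hH.cyclomaticNumber_le hp
  have h3 := hp.matchingNumber_le hl.le hcl
  rw [hl] at hseq hcseq hneg
  rw [show (2 * l + 1 - 1) / 2 = l by omega] at hneg
  have h4 := add_le_negIndex_of_typeD hB hseq hcseq hneg
  rw [← hl, hp.seqVerts_eq] at h4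
  omega

/-- If the cycles are disjoint and of Type D and the bridges are covered by a set `K` of vertices
outside the cycles which is matched by `π` to vertices whose neighbours lie in `K`, then the
upper bound is attained. -/
lemma le_negIndex_of_cover (hB : IsUnitWeight B) (hG : G.CyclesDisjoint) (hD : G.AllTypeD B)
    (K : Finset V) (π : V → V) (hKO : ∀ y ∈ K, y ∉ G.cycleVerts)
    (hπO : ∀ y ∈ K, π y ∉ G.cycleVerts) (hinj : Set.InjOn π K) (hπ : ∀ y ∈ K, π y ∉ K)
    (hadj : ∀ y ∈ K, G.Adj (π y) y) (hnbr : ∀ y ∈ K, ∀ z, G.Adj (π y) z → z ∈ K)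
    (hcov : ∀ a b, G.Adj a b → G.IsBridge s(a, b) → a ∈ K ∨ b ∈ K) :
    (G.matchingNumber : ℤ) + G.cyclomaticNumber ≤ G.negIndex B := by
  have hac : (G.isolate ((K : Set V) ∪ π '' K)ᶜ).IsAcyclic := by
    intro u p hp
    have hu : u ∈ (K : Set V) ∪ π '' K := by
      simpa only [Set.mem_compl_iff, not_not] using (p.adj_snd hp.not_nil).2.1
    have huO := mem_cycleVerts_iff.2 ⟨u, p.mapLe (isolate_le _),
      (Walk.isCycle_mapLe (isolate_le _)).2 hp, Walk.start_mem_support _⟩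
    rcases hu with hu | ⟨y, hy, rfl⟩
    · exact hKO u hu huO
    · exact hπO y hy huO
  have h1 := card_add_negIndex_isolate_le hB K π G hinj hπ hadj hnbr hac
  have h2 := le_negIndex_of_forall_not_isBridge hB (G.isolate K) (by
    intro e he
    induction e with | h a b
    have hnb : ¬ G.IsBridge s(a, b) := fun hb =>
      (hcov a b he.1 hb).elim (fun h => he.2.1 h) (fun h => he.2.2 h)
    obtain ⟨u, p, hp, hep⟩ := exists_isCycle_of_not_isBridge (G.mem_edgeSet.2 he.1) hnb
    exact hp.not_isBridge_isolate
      (fun x hx hxK => hKO x hxK (mem_cycleVerts_iff.2 ⟨u, p, hp, hx⟩)) hep)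
    (hG.anti (isolate_le _)) (hD.anti (isolate_le _))
  have h3 := matchingNumber_le_isolate_add_card (G := G) K
  -- Vertices of `K` lie on no cycle, so every edge removed is a bridge.
  have h4 : G.cyclomaticNumber ≤ (G.isolate K).cyclomaticNumber := by
    refine cyclomaticNumber_le_of_isBridge (isolate_le _) fun e he heK => ?_
    induction e with | h a b
    have hadj' : G.Adj a b := he
    by_cases ha : a ∈ K
    · exact isBridge_of_notMem_cycleVerts hadj' (hKO a ha)
    by_cases hb : b ∈ K
    · rw [Sym2.eq_swap]
      exact isBridge_of_notMem_cycleVerts hadj'.symm (hKO b hb)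
    · exact absurd ⟨hadj', ha, hb⟩ heK
  omega

end SimpleGraph

/-! ### The contracted graph is a forest. -/

namespace SimpleGraph

open Matrix

variable {V : Type*} {G H : SimpleGraph V}

/-! ### Contraction of the cycles -/

lemma Walk.IsCycle.mk_eq {u a b : V} {p : G.Walk u u} (hp : p.IsCycle) (ha : a ∈ p.support)
    (hb : b ∈ p.support) : (⟦a⟧ : Quotient G.cycleSetoid) = ⟦b⟧ :=
  Quotient.sound (Relation.EqvGen.rel _ _ ⟨_, ⟨u, p, hp, rfl⟩, p.mem_verts_toSubgraph.2 ha,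
    p.mem_verts_toSubgraph.2 hb⟩)

/-- No cycle uses a bridge, so a class, being generated by cycles, stays connected when the bridge
is deleted. -/
lemma IsBridge.reachable_of_mk_eq {e : Sym2 V} (he : G.IsBridge e) {a b : V}
    (h : (⟦a⟧ : Quotient G.cycleSetoid) = ⟦b⟧) : (G.deleteEdges {e}).Reachable a b := by
  classical
  have h' := Quotient.exact h
  change Relation.EqvGen _ a b at h'
  induction h' with
  | rel x y hxy =>
    obtain ⟨_, ⟨u, p, hp, rfl⟩, hx, hy⟩ := hxy
    rw [Walk.mem_verts_toSubgraph] at hx hy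
    have hp' : ∀ f ∈ p.edges, f ∈ (G.deleteEdges {e}).edgeSet := fun f hf => by
      rw [edgeSet_deleteEdges]
      refine ⟨p.edges_subset_edgeSet hf, ?_⟩
      rintro rfl
      exact he.notMem_edges_of_isCycle hp hf
    have hr : ∀ z ∈ p.support, (G.deleteEdges {e}).Reachable u z := fun z hz =>
      ⟨(p.transfer _ hp').takeUntil z (by rwa [Walk.support_transfer])⟩
    exact (hr x hx).symm.trans (hr y hy)
  | refl x => exact Reachable.refl x
  | symm x y hxy ih => exact (ih (Quotient.sound hxy)).symm
  | trans x y z hxy hyz ih1 ih2 =>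
    exact (ih1 (Quotient.sound hxy)).trans (ih2 (Quotient.sound hyz))

/-- The generating pairs lie on cycles, so the class of a vertex outside all cycles is a singleton.
-/
lemma eq_of_mk_eq {a b : V} (ha : a ∉ G.cycleVerts)
    (h : (⟦a⟧ : Quotient G.cycleSetoid) = ⟦b⟧) : a = b := by
  have h' := Quotient.exact h
  change Relation.EqvGen _ a b at h'
  have key : ∀ x y, Relation.EqvGen (fun u v => ∃ C : G.Subgraph, G.IsCycleSubgraph C ∧
      u ∈ C.verts ∧ v ∈ C.verts) x y → x = y ∨ (x ∈ G.cycleVerts ∧ y ∈ G.cycleVerts) := by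
    intro x y hxy
    induction hxy with
    | rel x y hxy =>
      obtain ⟨C, hC, hx, hy⟩ := hxy
      exact Or.inr ⟨⟨C, hC, hx⟩, ⟨C, hC, hy⟩⟩
    | refl x => exact Or.inl rfl
    | symm x y _ ih => exact ih.imp Eq.symm And.symm
    | trans x y z _ _ ih1 ih2 =>
      rcases ih1 with rfl | h1
      · exact ih2
      · rcases ih2 with rfl | h2
        · exact Or.inr h1
        · exact Or.inr ⟨h1.1, h2.2⟩
  exact (key a b h').resolve_right fun h => ha h.1

lemma IsBridge.mk_ne {a b : V} (h : G.IsBridge s(a, b)) :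
    (⟦a⟧ : Quotient G.cycleSetoid) ≠ ⟦b⟧ := fun hab => h (h.reachable_of_mk_eq hab)

lemma isBridge_of_mk_ne {a b : V} (hab : G.Adj a b)
    (h : (⟦a⟧ : Quotient G.cycleSetoid) ≠ ⟦b⟧) : G.IsBridge s(a, b) := by
  by_contra hb
  obtain ⟨u, p, hp, he⟩ := exists_isCycle_of_not_isBridge (G.mem_edgeSet.2 hab) hb
  exact h (hp.mk_eq (p.fst_mem_support_of_mem_edges he) (p.snd_mem_support_of_mem_edges he))

lemma contractCycles_adj_mk {a b : V} (hab : G.Adj a b)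
    (h : (⟦a⟧ : Quotient G.cycleSetoid) ≠ ⟦b⟧) : G.contractCycles.Adj ⟦a⟧ ⟦b⟧ :=
  ⟨h, a, b, hab, rfl, rfl⟩

lemma exists_of_contractCycles_adj {X Y : Quotient G.cycleSetoid}
    (h : G.contractCycles.Adj X Y) : ∃ a b, G.Adj a b ∧ ⟦a⟧ = X ∧ ⟦b⟧ = Y := h.2

/-- An edge of the contraction comes from a bridge `s(a, b)`. A walk avoiding the edge would lift to
a connection of `a` with `b` without the bridge, as each class stays connected without it. -/
lemma contractCycles_isAcyclic (G : SimpleGraph V) : G.contractCycles.IsAcyclic := by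
  rw [isAcyclic_iff_forall_adj_isBridge]
  intro X Y hXY
  obtain ⟨a, b, hab, rfl, rfl⟩ := exists_of_contractCycles_adj hXY
  have hbr := isBridge_of_mk_ne hab hXY.ne
  rw [isBridge_iff]
  rintro ⟨p⟩
  have key : ∀ (X Y : Quotient G.cycleSetoid)
      (_ : (G.contractCycles.deleteEdges {s(⟦a⟧, ⟦b⟧)}).Walk X Y) (c d : V), ⟦c⟧ = X → ⟦d⟧ = Y →
      (G.deleteEdges {s(a, b)}).Reachable c d := by
    intro X Y p
    induction p with
    | nil =>
      rintro c d rfl hd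
      exact hbr.reachable_of_mk_eq hd.symm
    | cons h p ih =>
      rintro c d rfl rfl
      rw [deleteEdges_adj] at h
      obtain ⟨x, y, hxy, hx, rfl⟩ := exists_of_contractCycles_adj h.1
      refine (hbr.reachable_of_mk_eq hx.symm).trans (Reachable.trans (Adj.reachable ?_)
        (ih y d rfl rfl))
      refine deleteEdges_adj.2 ⟨hxy, fun he => h.2 ?_⟩
      rw [← hx]
      have := congrArg (Sym2.map (Quotient.mk G.cycleSetoid)) he
      simpa using this
  exact hbr (key _ _ p a b rfl rfl)

/-- Two distinct classes are joined by at most one edge. -/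
lemma eq_of_adj_of_mk_eq {a b c d : V} (hab : G.Adj a b) (hcd : G.Adj c d)
    (hne : (⟦a⟧ : Quotient G.cycleSetoid) ≠ ⟦b⟧) (hac : (⟦c⟧ : Quotient G.cycleSetoid) = ⟦a⟧)
    (hbd : (⟦d⟧ : Quotient G.cycleSetoid) = ⟦b⟧) : c = a ∧ d = b := by
  have hbr := isBridge_of_mk_ne hab hne
  by_cases he : s(c, d) = s(a, b)
  · rcases Sym2.eq_iff.1 he with h | ⟨rfl, rfl⟩
    · exact h
    · exact absurd hac.symm hne
  · refine absurd ?_ (isBridge_iff.1 hbr)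
    exact (hbr.reachable_of_mk_eq hac).symm.trans
      ((Adj.reachable (deleteEdges_adj.2 ⟨hcd, he⟩)).trans (hbr.reachable_of_mk_eq hbd))

/-- A graph with disjoint cycles which has an edge has a pendant vertex, or a cycle which
is a component, or a cycle joined to its complement by one edge. -/
lemma CyclesDisjoint.exists_leaf [Finite V] (hG : G.CyclesDisjoint) (hne : G ≠ ⊥) :
    (∃ x y, G.Adj x y ∧ ∀ z, G.Adj x z → z = y) ∨
    ∃ (u : V) (p : G.Walk u u), p.IsCycle ∧
      ((∀ x ∈ p.support, ∀ z, G.Adj x z → s(x, z) ∈ p.edges) ∨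
      ∃ w, w ∉ p.support ∧ G.Adj u w ∧
        ∀ x ∈ p.support, ∀ z, G.Adj x z → s(x, z) ∈ p.edges ∨ x = u ∧ z = w) := by
  classical
  by_cases hT : G.contractCycles = ⊥
  · right
    have hnb : ∀ x y, G.Adj x y → ¬ G.IsBridge s(x, y) := by
      intro x y hxy hb
      have := contractCycles_adj_mk hxy hb.mk_ne
      rw [hT] at this
      exact this
    obtain ⟨a, b, hab⟩ := ne_bot_iff_exists_adj.1 hne
    obtain ⟨u, p, hp, -⟩ := exists_isCycle_of_not_isBridge (G.mem_edgeSet.2 hab) (hnb a b hab)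
    exact ⟨u, p, hp, Or.inl fun x hx z hxz => hG.mem_edges hp hx hxz (hnb x z hxz)⟩
  -- A leaf class is a single vertex or a cycle. All bridges leaving it go to the class `Y`, and two
  -- classes are joined by at most one edge.
  · obtain ⟨X, Y, hXY, hleaf⟩ := G.contractCycles_isAcyclic.exists_leaf hT
    obtain ⟨a, b, hab, rfl, rfl⟩ := exists_of_contractCycles_adj hXY
    by_cases ha : a ∈ G.cycleVerts
    · right
      obtain ⟨v, q, hq, haq⟩ := mem_cycleVerts_iff.1 ha
      have hp := (Walk.isCycle_rotate haq).2 hq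
      set p := q.rotate a haq with hpdef
      refine ⟨a, p, hp, Or.inr ⟨b, fun hb => hXY.ne (hp.mk_eq p.start_mem_support hb), hab, ?_⟩⟩
      intro x hx z hxz
      by_cases hb : G.IsBridge s(x, z)
      · right
        have hxa := hp.mk_eq hx p.start_mem_support
        have hT' := contractCycles_adj_mk hxz hb.mk_ne
        rw [hxa] at hT'
        exact eq_of_adj_of_mk_eq hab hxz hXY.ne hxa (hleaf _ hT')
      · exact Or.inl (hG.mem_edges hp hx hxz hb)
    · left
      refine ⟨a, b, hab, fun z hz => ?_⟩
      have hT' := contractCycles_adj_mk hz (isBridge_of_notMem_cycleVerts hz ha).mk_ne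
      exact (eq_of_adj_of_mk_eq hab hz hXY.ne rfl (hleaf _ hT')).2

section Finite

variable [Finite V]

lemma matchingNumber_induce_compl (S : Set V) :
    (G.induce Sᶜ).matchingNumber = (G.isolate S).matchingNumber := by
  classical
  apply le_antisymm
  · obtain ⟨M, hM, hk⟩ := (G.induce Sᶜ).exists_isMatchingSet
    have hinj : Function.Injective (Sym2.map (Subtype.val : (Sᶜ : Set V) → V)) :=
      Sym2.map.injective Subtype.val_injective
    rw [← hk, ← Finset.card_image_of_injective M hinj]
    refine IsMatchingSet.card_le ⟨?_, ?_⟩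
    · intro e he
      obtain ⟨f, hf, rfl⟩ := Finset.mem_image.1 he
      have := hM.1 f hf
      induction f with | h a b
      exact ⟨this, a.2, b.2⟩
    · intro e he f hf v hve hvf
      obtain ⟨e, he', rfl⟩ := Finset.mem_image.1 he
      obtain ⟨f, hf', rfl⟩ := Finset.mem_image.1 hf
      obtain ⟨x, hx, rfl⟩ := Sym2.mem_map.1 hve
      obtain ⟨y, hy, hxy⟩ := Sym2.mem_map.1 hvf
      rw [Subtype.val_injective hxy] at hy
      rw [hM.2 e he' f hf' x hx hy]
  · obtain ⟨M, hM, hk⟩ := (G.isolate S).exists_isMatchingSet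
    have hinj : Function.Injective (Sym2.map (Subtype.val : (Sᶜ : Set V) → V)) :=
      Sym2.map.injective Subtype.val_injective
    have himage : (M.preimage _ hinj.injOn).image (Sym2.map (Subtype.val : (Sᶜ : Set V) → V))
        = M := by
      rw [Finset.image_preimage, Finset.filter_eq_self]
      intro e he
      have := hM.1 e he
      induction e with | h a b
      exact ⟨s(⟨a, this.2.1⟩, ⟨b, this.2.2⟩), rfl⟩
    rw [← hk, ← himage, Finset.card_image_of_injective _ hinj]
    refine IsMatchingSet.card_le ⟨?_, ?_⟩
    · intro e he
      have := hM.1 _ (Finset.mem_preimage.1 he)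
      induction e with | h a b
      exact this.1
    · intro e he f hf v hve hvf
      exact hinj (hM.2 _ (Finset.mem_preimage.1 he) _ (Finset.mem_preimage.1 hf) v
        (Sym2.mem_map.2 ⟨v, hve, rfl⟩) (Sym2.mem_map.2 ⟨v, hvf, rfl⟩))

omit [Finite V] in
lemma IsMatchingSet.notMem_of_mem {S : Set V} {M : Finset (Sym2 V)}
    (hM : (G.isolate S).IsMatchingSet M) {e : Sym2 V} (he : e ∈ M) {v : V} (hv : v ∈ e) :
    v ∉ S := by
  obtain ⟨w, rfl⟩ := Sym2.mem_iff_exists.1 hv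
  exact (hM.1 _ he : (G.isolate S).Adj v w).2.1

/-- Vertices off the cycles are classes by themselves, so a matching there survives contraction.
This half of condition (c) always holds. -/
lemma matchingNumber_isolate_cycleVerts_le (G : SimpleGraph V) :
    (G.isolate G.cycleVerts).matchingNumber ≤ G.contractCycles.matchingNumber := by
  classical
  obtain ⟨M, hM, hk⟩ := (G.isolate G.cycleVerts).exists_isMatchingSet
  have key : ∀ e ∈ M, ∀ f ∈ M, ∀ X, X ∈ Sym2.map (Quotient.mk G.cycleSetoid) e →
      X ∈ Sym2.map (Quotient.mk G.cycleSetoid) f → e = f := by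
    intro e he f hf X hXe hXf
    obtain ⟨x, hx, rfl⟩ := Sym2.mem_map.1 hXe
    obtain ⟨y, hy, hxy⟩ := Sym2.mem_map.1 hXf
    have := eq_of_mk_eq (hM.notMem_of_mem hf hy) hxy
    rw [this] at hy
    exact hM.2 e he f hf x hx hy
  have hinj : Set.InjOn (Sym2.map (Quotient.mk G.cycleSetoid)) M := by
    intro e he f hf hef
    refine key e he f hf (Quotient.mk G.cycleSetoid e.out.1)
      (Sym2.mem_map.2 ⟨_, e.out_fst_mem, rfl⟩) ?_
    rw [← hef]
    exact Sym2.mem_map.2 ⟨_, e.out_fst_mem, rfl⟩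
  rw [← hk, ← Finset.card_image_of_injOn hinj]
  refine IsMatchingSet.card_le ⟨?_, ?_⟩
  · intro e he
    obtain ⟨f, hf, rfl⟩ := Finset.mem_image.1 he
    have := hM.1 f hf
    induction f with | h a b
    exact contractCycles_adj_mk this.1 fun h => this.1.ne (eq_of_mk_eq this.2.1 h)
  · intro e he f hf X hXe hXf
    obtain ⟨e, he', rfl⟩ := Finset.mem_image.1 he
    obtain ⟨f, hf', rfl⟩ := Finset.mem_image.1 hf
    rw [key e he' f hf' X hXe hXf]

end Finite

end SimpleGraph

/-! ### Lifting covers and matchings from the contracted graph. -/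

namespace SimpleGraph

open Matrix

variable {V : Type*} {G H : SimpleGraph V} [Finite V]

/-- If the contracted graph has no larger matching than the graph outside the cycles, then the
bridges are covered by vertices outside the cycles which are matched to vertices outside the
cover. -/
lemma exists_cover_of_contractCycles_matchingNumber_le
    (hc : G.contractCycles.matchingNumber ≤ (G.isolate G.cycleVerts).matchingNumber) :
    ∃ (K : Finset V) (π : V → V), (∀ y ∈ K, y ∉ G.cycleVerts) ∧ (∀ y ∈ K, π y ∉ G.cycleVerts) ∧
      Set.InjOn π K ∧ (∀ y ∈ K, π y ∉ K) ∧ (∀ y ∈ K, G.Adj (π y) y) ∧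
      (∀ y ∈ K, ∀ z, G.Adj (π y) z → z ∈ K) ∧
      (∀ a b, G.Adj a b → G.IsBridge s(a, b) → a ∈ K ∨ b ∈ K) := by
  classical
  obtain ⟨M, hM, hk⟩ := (G.isolate G.cycleVerts).exists_isMatchingSet
  obtain ⟨KT, hKT, hKc⟩ := G.contractCycles_isAcyclic.exists_cover
  -- Each edge of the matching `M` survives in the contraction, where the cover `KT` contains one of
  -- its ends; `φ` selects such an end.
  have hex : ∀ e : Sym2 V, ∃ v, e ∈ M → v ∈ e ∧ (⟦v⟧ : Quotient G.cycleSetoid) ∈ KT := by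
    intro e
    by_cases he : e ∈ M
    · have h1 := hM.1 e he
      induction e with | h a b
      rcases hKT _ _ (contractCycles_adj_mk h1.1 fun h => h1.1.ne (eq_of_mk_eq h1.2.1 h)) with h | h
      · exact ⟨a, fun _ => ⟨Sym2.mem_mk_left _ _, h⟩⟩
      · exact ⟨b, fun _ => ⟨Sym2.mem_mk_right _ _, h⟩⟩
    · exact ⟨e.out.1, fun h => absurd h he⟩
  choose φ hφ using hex
  have hφO : ∀ e ∈ M, φ e ∉ G.cycleVerts := fun e he => hM.notMem_of_mem he (hφ e he).1
  have hinj : Set.InjOn (fun e => (⟦φ e⟧ : Quotient G.cycleSetoid)) M := by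
    intro e he f hf hef
    have := eq_of_mk_eq (hφO e he) hef
    exact hM.2 e he f hf (φ e) (hφ e he).1 (this ▸ (hφ f hf).1)
  -- The selected ends are distinct members of `KT`, and `KT` has at most as many elements as `M`.
  -- So every class in the cover is a single vertex off the cycles.
  have himage : M.image (fun e => (⟦φ e⟧ : Quotient G.cycleSetoid)) = KT := by
    refine Finset.eq_of_subset_of_card_le (fun X hX => ?_) ?_
    · obtain ⟨e, he, rfl⟩ := Finset.mem_image.1 hX
      exact (hφ e he).2
    · rw [Finset.card_image_of_injOn hinj]
      omega
  set K := M.image φ with hKdef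
  have hmemK : ∀ v, (⟦v⟧ : Quotient G.cycleSetoid) ∈ KT → v ∈ K := by
    intro v hv
    rw [← himage] at hv
    obtain ⟨e, he, hev⟩ := Finset.mem_image.1 hv
    exact Finset.mem_image.2 ⟨e, he, eq_of_mk_eq (hφO e he) hev⟩
  -- The partner `π y` is the other end of the matching edge whose selected end is `y`.
  have hex : ∀ y, ∃ x, y ∈ K → ∃ e ∈ M, φ e = y ∧ e = s(x, y) := by
    intro y
    by_cases hy : y ∈ K
    · obtain ⟨e, he, rfl⟩ := Finset.mem_image.1 hy
      obtain ⟨x, hx⟩ := Sym2.mem_iff_exists.1 (hφ e he).1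
      exact ⟨x, fun _ => ⟨e, he, rfl, by rw [Sym2.eq_swap]; exact hx⟩⟩
    · exact ⟨y, fun h => absurd h hy⟩
  choose π hπ using hex
  have hπM : ∀ y ∈ K, s(π y, y) ∈ M ∧ φ s(π y, y) = y := fun y hy => by
    obtain ⟨e, he, hey, rfl⟩ := hπ y hy
    exact ⟨he, hey⟩
  have hπO : ∀ y ∈ K, π y ∉ G.cycleVerts := fun y hy =>
    hM.notMem_of_mem (hπM y hy).1 (Sym2.mem_mk_left _ _)
  have hKO : ∀ y ∈ K, y ∉ G.cycleVerts := fun y hy =>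
    hM.notMem_of_mem (hπM y hy).1 (Sym2.mem_mk_right _ _)
  have hadj : ∀ y ∈ K, G.Adj (π y) y := fun y hy =>
    (hM.1 _ (hπM y hy).1 : (G.isolate G.cycleVerts).Adj (π y) y).1
  have hπK : ∀ y ∈ K, π y ∉ K := by
    intro y hy hmem
    obtain ⟨f, hf, hfy⟩ := Finset.mem_image.1 hmem
    have := hM.2 f hf _ (hπM y hy).1 (π y) (hfy ▸ (hφ f hf).1) (Sym2.mem_mk_left _ _)
    rw [this, (hπM y hy).2] at hfy
    have := hadj y hy
    rw [← hfy] at this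
    exact this.ne rfl
  have hcov : ∀ a b, G.Adj a b → G.IsBridge s(a, b) → a ∈ K ∨ b ∈ K := fun a b hab hb =>
    (hKT _ _ (contractCycles_adj_mk hab hb.mk_ne)).imp (hmemK a) (hmemK b)
  refine ⟨K, π, hKO, hπO, ?_, hπK, hadj, ?_, hcov⟩
  · intro y hy z hz hyz
    have := hM.2 _ (hπM y hy).1 _ (hπM z hz).1 (π y) (Sym2.mem_mk_left _ _)
      (by rw [hyz]; exact Sym2.mem_mk_left _ _)
    rw [← (hπM y hy).2, this, (hπM z hz).2]
  · intro y hy z hz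
    exact (hcov _ _ hz (isBridge_of_notMem_cycleVerts hz (hπO y hy))).resolve_left (hπK y hy)

/-- In a disjoint union of odd cycles there is a maximum matching which avoids a given set
meeting each cycle in at most one vertex. -/
lemma matchingNumber_le_isolate_of_odd (S : Set V) (H : SimpleGraph V) :
    (∀ e ∈ H.edgeSet, ¬ H.IsBridge e) → H.CyclesDisjoint →
    (∀ (u : V) (p : H.Walk u u), p.IsCycle → Odd p.length) →
    (∀ (u : V) (p : H.Walk u u), p.IsCycle → ∀ x ∈ p.support, ∀ y ∈ p.support,
      x ∈ S → y ∈ S → x = y) →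
    H.matchingNumber ≤ (H.isolate S).matchingNumber := by
  classical
  induction H using WellFoundedLT.induction with | ind H ih
  intro hnb hH hodd hS
  by_cases hbot : H = ⊥
  · subst hbot
    rw [matchingNumber_bot]
    exact Nat.zero_le _
  obtain ⟨a, b, hab⟩ := ne_bot_iff_exists_adj.1 hbot
  obtain ⟨v, q, hq, -⟩ := exists_isCycle_of_not_isBridge (H.mem_edgeSet.2 hab) (hnb _ hab)
  -- The cycle is based at its vertex in `S`, if there is one. The other `2 * l` vertices avoid `S`
  -- and are matched in pairs along the cycle.
  obtain ⟨u, p, hp, hbase⟩ : ∃ (u : V) (p : H.Walk u u), p.IsCycle ∧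
      ∀ x ∈ p.support, x ∈ S → x = u := by
    by_cases hx : ∃ x ∈ q.support, x ∈ S
    · obtain ⟨x, hxq, hxS⟩ := hx
      have hp := (Walk.isCycle_rotate hxq).2 hq
      exact ⟨x, _, hp, fun y hy hyS => hS _ _ hp y hy x (Walk.start_mem_support _) hyS hxS⟩
    · push Not at hx
      exact ⟨v, q, hq, fun x hxq hxS => absurd hxS (hx x hxq)⟩
  have hcl : ∀ x ∈ p.support, ∀ z, H.Adj x z → s(x, z) ∈ p.edges := fun x hx z hxz =>
    hH.mem_edges hp hx hxz (hnb _ hxz)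
  have hseq := hp.isCycleSeq (fun e he => p.edges_subset_edgeSet he)
  obtain ⟨l, hl⟩ := hodd u p hp
  have hle := isolate_le (G := H) {x | x ∈ p.support}
  have h1 := ih (H.isolate {x | x ∈ p.support})
    (isolate_lt (p.adj_snd hp.not_nil) p.start_mem_support)
    (by
      intro e he
      obtain ⟨v, q, hq, heq⟩ := exists_isCycle_of_not_isBridge (edgeSet_mono (isolate_le _) he)
        (hnb e (edgeSet_mono (isolate_le _) he))
      refine hq.not_isBridge_isolate (fun x hxq hxp => ?_) heq
      have hep := hH q p hq hp x hxq hxp e heq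
      induction e with | h c d
      exact he.2.1 (p.fst_mem_support_of_mem_edges hep))
    (hH.anti hle)
    (fun v q hq => by
      simpa using hodd v (q.mapLe hle) ((Walk.isCycle_mapLe hle).2 hq))
    (fun v q hq x hx y hy => hS v (q.mapLe hle) ((Walk.isCycle_mapLe hle).2 hq) x
      (by simpa using hx) y (by simpa using hy))
  have h2 := hp.matchingNumber_le hl.le hcl
  have hv : ∀ i < 2 * l, p.getVert (i + 1) ∉ S := by
    intro i hi hiS
    have h0 := hbase _ (p.getVert_mem_support _) hiS
    have := hseq.inj (i + 1) (by omega) 0 (by omega) (by rw [h0, p.getVert_zero])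
    omega
  have h3 := matchingNumber_isolate_add_le_of_path (G := H.isolate S)
    (fun i => p.getVert (i + 1)) l
    (fun i hi j hj hij => by
      have hi' : i < 2 * l := hi
      have hj' : j < 2 * l := hj
      have := hseq.inj (i + 1) (by omega) (j + 1) (by omega) hij
      omega)
    (fun i hi => ⟨hseq.adj (2 * i + 1) (by omega), hv _ (by omega), hv _ (by omega)⟩)
    (S := {x | x ∈ p.support}) (fun i _ => p.getVert_mem_support _)
  rw [isolate_isolate] at h1 h3
  rw [Set.union_comm] at h3
  omega

omit [Finite V] in
lemma cyclePart_not_isBridge {e : Sym2 V} (he : e ∈ G.cyclePart.edgeSet) :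
    ¬ G.cyclePart.IsBridge e := by
  induction e with | h a b
  obtain ⟨u, p, hp, hep⟩ := exists_isCycle_of_not_isBridge (G.mem_edgeSet.2 he.1) he.2
  exact fun hb => hb.notMem_edges_of_isCycle (hp.transfer hp.edges_subset_cyclePart)
    (by rwa [Walk.edges_transfer])

/-- A matching of the contracted graph can be lifted and extended by near perfect matchings of
the odd cycles. -/
lemma contractCycles_matchingNumber_add_le (hG : G.CyclesDisjoint)
    (hodd : ∀ (u : V) (p : G.Walk u u), p.IsCycle → Odd p.length) :
    G.contractCycles.matchingNumber + G.cyclePart.matchingNumber ≤ G.matchingNumber := by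
  classical
  obtain ⟨M, hM, hk⟩ := G.contractCycles.exists_isMatchingSet
  have hex : ∀ e ∈ M, ∃ f ∈ G.edgeSet, Sym2.map (Quotient.mk G.cycleSetoid) f = e := by
    intro e he
    have := hM.1 e he
    induction e with | h X Y
    obtain ⟨a, b, hab, rfl, rfl⟩ := exists_of_contractCycles_adj this
    exact ⟨s(a, b), hab, rfl⟩
  obtain ⟨N, hNE, hinj, himage⟩ := Finset.exists_subset_injOn_image_eq_of_surjOn
    (f := Sym2.map (Quotient.mk G.cycleSetoid)) G.edgeSet M (fun e he => hex e he)
  set S : Set V := {v | ∃ f ∈ N, v ∈ f} with hS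
  -- The lifted edges have their ends in distinct classes, so `S` meets each cycle in at most one
  -- vertex.
  have hcl : ∀ v ∈ S, ∀ w ∈ S, (⟦v⟧ : Quotient G.cycleSetoid) = ⟦w⟧ → v = w := by
    rintro v ⟨f, hf, hvf⟩ w ⟨g, hg, hwg⟩ hvw
    have hfg : f = g := by
      refine hinj hf hg (hM.2 _ (himage ▸ Finset.mem_image_of_mem _ hf) _
        (himage ▸ Finset.mem_image_of_mem _ hg) ⟦v⟧ (Sym2.mem_map.2 ⟨v, hvf, rfl⟩) ?_)
      rw [hvw]
      exact Sym2.mem_map.2 ⟨w, hwg, rfl⟩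
    subst hfg
    by_contra hne
    obtain ⟨x, rfl⟩ := Sym2.mem_iff_exists.1 hvf
    rcases Sym2.mem_iff.1 hwg with rfl | rfl
    · exact hne rfl
    · have h1 : G.contractCycles.Adj ⟦v⟧ ⟦w⟧ := hM.1 _ (himage ▸ Finset.mem_image_of_mem
        (Sym2.map (Quotient.mk G.cycleSetoid)) hf)
      exact h1.ne hvw
  have hNM : G.IsMatchingSet N := by
    refine ⟨hNE, fun e he f hf v hve hvf => hinj he hf ?_⟩
    exact hM.2 _ (himage ▸ Finset.mem_image_of_mem _ he) _
        (himage ▸ Finset.mem_image_of_mem _ hf) ⟦v⟧ (Sym2.mem_map.2 ⟨v, hve, rfl⟩)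
        (Sym2.mem_map.2 ⟨v, hvf, rfl⟩)
  have h1 := hNM.card_add_isolate_le (S := S) fun e he v hv => ⟨e, he, hv⟩
  have h2 : N.card = M.card := by rw [← himage, Finset.card_image_of_injOn hinj]
  have hle := cyclePart_le (G := G)
  have h3 := matchingNumber_le_isolate_of_odd S G.cyclePart (fun e he => cyclePart_not_isBridge he)
    (hG.anti hle)
    (fun v q hq => by
      simpa using hodd v (q.mapLe hle) ((Walk.isCycle_mapLe hle).2 hq))
    (fun v q hq x hx y hy hxS hyS => hcl x hxS y hyS
      (((Walk.isCycle_mapLe hle).2 hq).mk_eq (by simpa using hx) (by simpa using hy)))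
  have h4 := matchingNumber_mono (isolate_mono hle (Set.Subset.refl S))
  omega

end SimpleGraph

/-! ### Equality forces Type D and controls the maximum matchings. -/

namespace SimpleGraph

open Matrix

variable {V : Type*} {G H : SimpleGraph V}

lemma Walk.getVert_transfer {u v : V} (p : G.Walk u v) (h : ∀ e ∈ p.edges, e ∈ H.edgeSet) :
    (p.transfer H h).getVert = p.getVert := by
  ext i
  rw [Walk.getVert_eq_getD_support, Walk.getVert_eq_getD_support, Walk.support_transfer]

lemma AllTypeD.of_edges {B : Matrix V V ℂ} (hH : H.AllTypeD B) {u : V} {p : G.Walk u u}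
    (hp : p.IsCycle) (h : ∀ e ∈ p.edges, e ∈ H.edgeSet) : IsTypeDSeq B p.length p.getVert := by
  have := hH u _ (hp.transfer h)
  rwa [Walk.getVert_transfer, Walk.length_transfer] at this

lemma Walk.IsCycle.length_eq {u v : V} {p : G.Walk u u} {q : G.Walk v v} (hp : p.IsCycle)
    (hq : q.IsCycle) (h : ∀ e, e ∈ p.edges ↔ e ∈ q.edges) : p.length = q.length := by
  classical
  rw [← p.length_edges, ← q.length_edges]
  exact ((List.perm_ext_iff_of_nodup hp.edges_nodup hq.edges_nodup).2 h).length_eq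

section Finite

variable [Finite V]

/-- The vertices of a cycle other than its base point can be matched in pairs. -/
lemma Walk.IsCycle.matchingNumber_isolate_add_le {u : V} {p : G.Walk u u} (hp : p.IsCycle) {l : ℕ}
    (hl : p.length = 2 * l + 1)
    (hH : ∀ i, 1 ≤ i → i < 2 * l → H.Adj (p.getVert i) (p.getVert (i + 1))) :
    (H.isolate {x | x ∈ p.support}).matchingNumber + l ≤ H.matchingNumber := by
  have hseq := hp.isCycleSeq (fun e he => p.edges_subset_edgeSet he)
  refine matchingNumber_isolate_add_le_of_path (fun i => p.getVert (i + 1)) l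
    (fun i hi j hj hij => ?_) (fun i hi => hH (2 * i + 1) (by omega) (by omega))
    (fun i _ => p.getVert_mem_support _)
  have hi' : i < 2 * l := hi
  have hj' : j < 2 * l := hj
  have := hseq.inj (i + 1) (by omega) (j + 1) (by omega) hij
  omega

end Finite

variable [Fintype V] {B : Matrix V V ℂ}

/-- A cycle joined to its complement by at most one edge, with the graph attaining the
upper bound, has odd length. -/
lemma odd_length_of_leaf_cycle (h : (G.matchingNumber : ℤ) + G.cyclomaticNumber ≤ G.negIndex B)
    {u : V} {p : G.Walk u u} (hp : p.IsCycle)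
    (hcl : ∀ x ∈ p.support, x ≠ u → ∀ z, G.Adj x z → s(x, z) ∈ p.edges) : Odd p.length := by
  classical
  by_contra hodd
  obtain ⟨l, hl⟩ := Nat.not_odd_iff_even.1 hodd
  have hseq := hp.isCycleSeq (fun e he => p.edges_subset_edgeSet he)
  have h3 := hseq.three_le
  -- In an even cycle the vertices at even positions include `u` and cover all edges at the cycle.
  -- Isolating these at most `l` vertices costs the matching number at least `l` and the cyclomatic
  -- number at least one, so equality fails.
  set K : Finset V := (Finset.range l).image fun i => p.getVert (2 * i) with hK
  have hKc : K.card ≤ l := Finset.card_image_le.trans (by rw [Finset.card_range])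
  have hKmem : ∀ i, 2 * i ≤ p.length → p.getVert (2 * i) ∈ K := by
    intro i hi
    rcases hi.lt_or_eq with h' | h'
    · exact Finset.mem_image.2 ⟨i, Finset.mem_range.2 (by omega), rfl⟩
    · rw [h', hseq.wrap]
      exact Finset.mem_image.2 ⟨0, Finset.mem_range.2 (by omega), rfl⟩
  have hu : u ∈ K := by simpa using hKmem 0 (by omega)
  have hdisj : ∀ a b, G.Adj a b → a ∉ K → b ∉ K → a ∉ p.support := by
    intro a b hab ha hb hap
    have hau : a ≠ u := fun h => ha (h ▸ hu)
    have := hcl a hap hau b hab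
    rw [← Walk.adj_toSubgraph_iff_mem_edges, Walk.toSubgraph_adj_iff] at this
    obtain ⟨j, hj, hjl⟩ := this
    obtain ⟨t, rfl | rfl⟩ := Nat.even_or_odd' j
    · have hmem := hKmem t (by omega)
      rcases Sym2.eq_iff.1 hj with ⟨rfl, -⟩ | ⟨rfl, -⟩
      · exact ha hmem
      · exact hb hmem
    · have hmem := hKmem (t + 1) (by omega)
      rcases Sym2.eq_iff.1 hj with ⟨-, rfl⟩ | ⟨-, rfl⟩
      · exact hb hmem
      · exact ha hmem
  have hle : G.isolate K ≤ G.isolate {x | x ∈ p.support} := fun a b hab =>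
    ⟨hab.1, hdisj a b hab.1 hab.2.1 hab.2.2, hdisj b a hab.1.symm hab.2.2 hab.2.1⟩
  have h1 := negIndex_le_isolate_add_card (B := B) G K
  have h2 := negIndex_le_matchingNumber_add_cyclomaticNumber (B := B) (G.isolate K)
  have h4 := cyclomaticNumber_isolate_add_one_le hp p.start_mem_support
    (S := (K : Set V)) hu
  have h5 := matchingNumber_mono hle
  have h6 := matchingNumber_isolate_add_le_of_path (G := G) p.getVert l
    (fun i hi j hj hij => by
      have hi' : i < 2 * l := hi
      have hj' : j < 2 * l := hj
      exact hseq.inj i (by omega) j (by omega) hij)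
    (fun i hi => hseq.adj _ (by omega)) (S := {x | x ∈ p.support})
    (fun i _ => p.getVert_mem_support _)
  omega

/-- A cycle joined to its complement by at most one edge, with the graph attaining the
upper bound, is of Type D. -/
lemma isTypeDSeq_of_leaf_cycle (hB : IsUnitWeight B) (hG : G.CyclesDisjoint)
    (h : (G.matchingNumber : ℤ) + G.cyclomaticNumber ≤ G.negIndex B)
    {u : V} {p : G.Walk u u} (hp : p.IsCycle)
    (hcl : (∀ x ∈ p.support, ∀ z, G.Adj x z → s(x, z) ∈ p.edges) ∨
      ∃ w, w ∉ p.support ∧ G.Adj u w ∧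
        ∀ x ∈ p.support, ∀ z, G.Adj x z → s(x, z) ∈ p.edges ∨ x = u ∧ z = w)
    {v x : V} {q : G.Walk v v} (hq : q.IsCycle) (hxp : x ∈ p.support) (hxq : x ∈ q.support) :
    IsTypeDSeq B q.length q.getVert := by
  have hcl' : ∀ x ∈ p.support, x ≠ u → ∀ z, G.Adj x z → s(x, z) ∈ p.edges := by
    intro x hx hxu z hz
    rcases hcl with h | ⟨w, -, -, h⟩
    · exact h x hx z hz
    · exact (h x hx z hz).resolve_right fun h => hxu h.1
  obtain ⟨l, hl⟩ := odd_length_of_leaf_cycle h hp hcl'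
  have hedges : ∀ e, e ∈ p.edges ↔ e ∈ q.edges := fun e =>
    ⟨hG p q hp hq x hxp hxq e, hG q p hq hp x hxq hxp e⟩
  have hsupp : ∀ z, z ∈ q.support ↔ z ∈ p.support := fun z =>
    ⟨hG.support_subset hq hp hxq hxp z, hG.support_subset hp hq hxp hxq z⟩
  have hql : q.length = 2 * l + 1 := by rw [← hp.length_eq hq hedges, hl]
  have hSq : {x | x ∈ q.support} = {x | x ∈ p.support} := Set.ext hsupp
  have hseq := hp.isCycleSeq (fun e he => p.edges_subset_edgeSet he)
  refine ⟨⟨l, hql⟩, ?_⟩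
  rw [hql, show (2 * l + 1 - 1) / 2 = l by omega]
  by_contra hneg
  rw [not_lt] at hneg
  have hc := cyclomaticNumber_isolate_add_one_le hp p.start_mem_support
    (S := {x | x ∈ p.support}) p.start_mem_support
  have hm := hp.matchingNumber_isolate_add_le (H := G) hl fun i h1 h2 => hseq.adj i (by omega)
  rcases hcl with hcl | ⟨w, hwp, huw, hcl⟩
  · have hqs := hq.isCycleSeq (fun e he => q.edges_subset_edgeSet he)
    have hqc := hq.isClosedSeq (H := G) fun z hz t hzt =>
      (hedges _).1 (hcl z ((hsupp z).1 hz) t hzt)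
    rw [hql] at hqs hqc
    have h1 := negIndex_le_of_not_typeD hB hqs hqc hneg
    rw [← hql, hq.seqVerts_eq, hSq] at h1
    have h2 := negIndex_le_matchingNumber_add_cyclomaticNumber (B := B)
      (G.isolate {x | x ∈ p.support})
    omega
  -- Isolating `w` turns the cycle into a component, which adds at most `l` to the inertia if it is
  -- not of Type D. But the edge from `u` to `w` and the `l` pairs on the rest of the cycle give `l
  -- + 1` matching edges, which already pay for `w` and the cycle, so the extra one from the
  -- cyclomatic number is missing.
  · have hqs := hq.isCycleSeq (H := G.isolate {w}) (q.edges_subset_of_support_disjoint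
      fun z hz hzw => hwp ((hsupp w).1 (Set.mem_singleton_iff.1 hzw ▸ hz)))
    have hqc := hq.isClosedSeq (H := G.isolate {w}) fun z hz t hzt =>
      (hedges _).1 ((hcl z ((hsupp z).1 hz) t hzt.1).resolve_right fun h => hzt.2.2 h.2)
    rw [hql] at hqs hqc
    have h1 := negIndex_le_of_not_typeD hB hqs hqc hneg
    rw [← hql, hq.seqVerts_eq, hSq, isolate_isolate, Set.union_comm, ← isolate_isolate] at h1
    have h2 := negIndex_le_matchingNumber_add_cyclomaticNumber (B := B)
      ((G.isolate {x | x ∈ p.support}).isolate {w})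
    have h3 := negIndex_le_isolate_singleton_add_one (B := B) G w
    have h4 := cyclomaticNumber_mono (isolate_le (G := G.isolate {x | x ∈ p.support}) {w})
    have h5 := negIndex_le_isolate_singleton_add_one (B := B) G u
    have h6 := negIndex_le_matchingNumber_add_cyclomaticNumber (B := B) (G.isolate {u})
    have h7 := cyclomaticNumber_isolate_add_one_le hp p.start_mem_support
      (S := {u}) (Set.mem_singleton u)
    have h8 := hp.matchingNumber_le (H := G.isolate {u}) hl.le
      (fun z hz t hzt => hcl' z hz hzt.2.1 t hzt.1)
    have h9 := matchingNumber_mono (isolate_mono (isolate_le (G := G) {u})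
      (Set.Subset.refl {x | x ∈ p.support}))
    have h10 : (G.isolate {u, w}).matchingNumber + 1 ≤ G.matchingNumber :=
      matchingNumber_isolate_add_one_le huw (by simp) (by simp)
    have hav : ∀ i, 1 ≤ i → i ≤ 2 * l → p.getVert i ∉ ({u, w} : Set V) := by
      rintro i h1 h2 (hu | hw)
      · have := hseq.inj i (by omega) 0 (by omega) (by rw [hu, p.getVert_zero])
        omega
      · exact hwp (Set.mem_singleton_iff.1 hw ▸ p.getVert_mem_support i)
    have h11 := hp.matchingNumber_isolate_add_le (H := G.isolate {u, w}) hl fun i h1 h2 =>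
      ⟨hseq.adj i (by omega), hav i h1 h2.le, hav _ (by omega) (by omega)⟩
    have h12 : (G.isolate {x | x ∈ p.support}).isolate {w}
        ≤ (G.isolate {u, w}).isolate {x | x ∈ p.support} := by
      intro a b hab
      refine ⟨⟨hab.1.1, ?_, ?_⟩, hab.1.2⟩
      · rintro (rfl | h)
        · exact hab.1.2.1 p.start_mem_support
        · exact hab.2.1 h
      · rintro (rfl | h)
        · exact hab.1.2.2 p.start_mem_support
        · exact hab.2.2 h
    have h13 := matchingNumber_mono h12
    omega

/-- If the upper bound is attained then all cycles are of Type D, and some maximum matching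
consists of near perfect matchings of the cycles and a matching outside the cycles. -/
theorem allTypeD_and_matchingNumber_le (hB : IsUnitWeight B) (G : SimpleGraph V) :
    G.CyclesDisjoint → (G.matchingNumber : ℤ) + G.cyclomaticNumber ≤ G.negIndex B →
    G.AllTypeD B ∧
      G.matchingNumber ≤ G.cyclePart.matchingNumber + (G.isolate G.cycleVerts).matchingNumber := by
  induction G using WellFoundedLT.induction with | ind G ih
  intro hG h
  by_cases hbot : G = ⊥
  · subst hbot
    refine ⟨fun u p hp => absurd hp (isAcyclic_bot p), ?_⟩
    rw [matchingNumber_bot]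
    exact Nat.zero_le _
  rcases hG.exists_leaf hbot with ⟨x, y, hxy, hx⟩ | ⟨u, p, hp, hcl⟩
  · have hle : ∀ H : SimpleGraph V, H ≤ G → H.isolate {y} ≤ H.isolate {x, y} := by
      rintro H hH a b ⟨hab, ha, hb⟩
      refine ⟨hab, ?_, ?_⟩
      · rintro (rfl | h)
        · exact hb (hx _ (hH hab))
        · exact ha h
      · rintro (rfl | h)
        · exact ha (hx _ (hH hab.symm))
        · exact hb h
    have h1 := negIndex_le_isolate_singleton_add_one (B := B) G y
    have h2 : (G.isolate {x, y}).matchingNumber + 1 ≤ G.matchingNumber :=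
      matchingNumber_isolate_add_one_le hxy (by simp) (by simp)
    have h3 := matchingNumber_mono (hle G le_rfl)
    have h4 := cyclomaticNumber_mono (isolate_le (G := G) {y})
    -- If `y` were on a cycle, isolating it would lower both the matching number and the cyclomatic
    -- number, but the inertia by at most one.
    have hyO : y ∉ G.cycleVerts := by
      intro hy
      obtain ⟨u, p, hp, hyp⟩ := mem_cycleVerts_iff.1 hy
      have h5 := cyclomaticNumber_isolate_add_one_le hp hyp (Set.mem_singleton y)
      have h6 := negIndex_le_matchingNumber_add_cyclomaticNumber (B := B) (G.isolate {y})
      omega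
    have hxO : x ∉ G.cycleVerts := by
      intro hxO
      obtain ⟨u, p, hp, hxp⟩ := mem_cycleVerts_iff.1 hxO
      obtain ⟨z, hz⟩ := hp.exists_mem_edges hxp
      have hzy := hx z (p.adj_of_mem_edges hz)
      subst hzy
      exact hyO (mem_cycleVerts_iff.2 ⟨u, p, hp, p.snd_mem_support_of_mem_edges hz⟩)
    have htr : ∀ (u : V) (p : G.Walk u u), p.IsCycle →
        ∀ e ∈ p.edges, e ∈ (G.isolate {y}).edgeSet := fun u p hp =>
      p.edges_subset_of_support_disjoint fun z hz hzy =>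
        hyO (mem_cycleVerts_iff.2 ⟨u, p, hp, Set.mem_singleton_iff.1 hzy ▸ hz⟩)
    obtain ⟨hD, hm⟩ := ih (G.isolate {y}) (isolate_lt hxy.symm rfl)
      (hG.anti (isolate_le _)) (by omega)
    refine ⟨fun u p hp => hD.of_edges hp (htr u p hp), ?_⟩
    have h5 := matchingNumber_mono (cyclePart_mono (isolate_le (G := G) {y}))
    have hO : G.cycleVerts ⊆ (G.isolate {y}).cycleVerts := by
      intro z hz
      obtain ⟨u, p, hp, hzp⟩ := mem_cycleVerts_iff.1 hz
      exact mem_cycleVerts_iff.2 ⟨u, _, hp.transfer (htr u p hp),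
        by rwa [Walk.support_transfer]⟩
    -- Both `x` and `y` are off the cycles, so the edge between them returns to the matching outside
    -- the cycles.
    have h6 : ((G.isolate G.cycleVerts).isolate {x, y}).matchingNumber + 1
        ≤ (G.isolate G.cycleVerts).matchingNumber :=
      matchingNumber_isolate_add_one_le (G := G.isolate G.cycleVerts) (x := x) (y := y)
        ⟨hxy, hxO, hyO⟩ (by simp) (by simp)
    have h7 : (G.isolate {y}).isolate (G.isolate {y}).cycleVerts
        ≤ (G.isolate G.cycleVerts).isolate {x, y} := by
      refine le_trans ?_ (hle _ (isolate_le _))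
      rw [isolate_isolate, isolate_isolate, Set.union_comm]
      exact isolate_mono le_rfl (Set.union_subset_union_left _ hO)
    have h8 := matchingNumber_mono h7
    have h9 := matchingNumber_le_isolate_add_card (G := G) {y}
    rw [Finset.coe_singleton, Finset.card_singleton] at h9
    omega
  · have hcl' : ∀ x ∈ p.support, x ≠ u → ∀ z, G.Adj x z → s(x, z) ∈ p.edges := by
      intro x hx hxu z hz
      rcases hcl with h | ⟨w, -, -, h⟩
      · exact h x hx z hz
      · exact (h x hx z hz).resolve_right fun h => hxu h.1
    obtain ⟨l, hl⟩ := odd_length_of_leaf_cycle h hp hcl'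
    have h1 := negIndex_le_isolate_singleton_add_one (B := B) G u
    have h2 := negIndex_le_matchingNumber_add_cyclomaticNumber (B := B) (G.isolate {u})
    have h3 := cyclomaticNumber_isolate_add_one_le hp p.start_mem_support
      (S := {u}) (Set.mem_singleton u)
    have h4 := matchingNumber_mono (isolate_le (G := G) {u})
    obtain ⟨hD, hm⟩ := ih (G.isolate {u}) (isolate_lt (p.adj_snd hp.not_nil) rfl)
      (hG.anti (isolate_le _)) (by omega)
    have htr : ∀ (v : V) (q : G.Walk v v), (∀ x ∈ q.support, x ∉ p.support) →
        ∀ e ∈ q.edges, e ∈ (G.isolate {u}).edgeSet := fun v q hq =>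
      q.edges_subset_of_support_disjoint fun z hz hzu =>
        hq z hz (Set.mem_singleton_iff.1 hzu ▸ p.start_mem_support)
    refine ⟨fun v q hq => ?_, ?_⟩
    · by_cases hmeet : ∀ x ∈ q.support, x ∉ p.support
      · exact hD.of_edges hq (htr v q hmeet)
      · push Not at hmeet
        obtain ⟨x, hxq, hxp⟩ := hmeet
        exact isTypeDSeq_of_leaf_cycle hB hG h hp hcl hq hxp hxq
    -- Equality forces `G.isolate {u}` to have the same matching number as `G`. In the bound for it,
    -- the broken cycle contributes at most `l` to the matching off the cycles; in `G` these `l`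
    -- edges are counted in the cycle part instead.
    · have hcle : (G.isolate {u}).cyclePart ≤ G.cyclePart.isolate {x | x ∈ p.support} := by
        have key : ∀ a b, (G.isolate {u}).cyclePart.Adj a b → a ∉ p.support := by
          intro a b hab hap
          obtain ⟨v, q, hq, he⟩ := exists_isCycle_of_not_isBridge
            ((G.isolate {u}).mem_edgeSet.2 hab.1) hab.2
          have hqm := (Walk.isCycle_mapLe (isolate_le {u})).2 hq
          have hus := hG.support_subset hp hqm hap
            (by simpa using q.fst_mem_support_of_mem_edges he) u p.start_mem_support
          rw [Walk.support_mapLe_eq_support] at hus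
          obtain ⟨z, hz⟩ := hq.exists_mem_edges hus
          exact (q.adj_of_mem_edges hz).2.1 rfl
        exact fun a b hab => ⟨cyclePart_mono (isolate_le _) hab, key a b hab, key b a hab.symm⟩
      have hseq := hp.isCycleSeq hp.edges_subset_cyclePart
      have h5 := matchingNumber_mono hcle
      have h6 := hp.matchingNumber_isolate_add_le (H := G.cyclePart) hl fun i _ h2 =>
        hseq.adj i (by omega)
      have h7 := hp.matchingNumber_le
        (H := (G.isolate {u}).isolate (G.isolate {u}).cycleVerts) hl.le
        (fun z hz t hzt => hcl' z hz hzt.1.2.1 t hzt.1.1)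
      have hOle : ((G.isolate {u}).isolate (G.isolate {u}).cycleVerts).isolate
          {x | x ∈ p.support} ≤ G.isolate G.cycleVerts := by
        rw [isolate_isolate]
        refine isolate_mono (isolate_le _) fun z hz => ?_
        obtain ⟨v, q, hq, hzq⟩ := mem_cycleVerts_iff.1 hz
        by_cases hzp : z ∈ p.support
        · exact Or.inr hzp
        · refine Or.inl (mem_cycleVerts_iff.2 ⟨v, _, hq.transfer (htr v q fun x hxq hxp => hzp ?_),
            by rwa [Walk.support_transfer]⟩)
          exact hG.support_subset hq hp hxq hxp z hzq
      have h8 := matchingNumber_mono hOle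
      omega

end SimpleGraph

/-! ### Gain graphs as weighted graphs, and the theorem. -/

namespace UnitGainGraph

open Matrix

variable {V : Type*} (Φ : UnitGainGraph V)

open Classical in
/-- The gains of a gain graph, extended by one to pairs of vertices which are not adjacent. -/
noncomputable def gainMatrix : Matrix V V ℂ :=
  Matrix.of fun u v => if h : Φ.graph.Adj u v then (Φ.gain ⟨(u, v), h⟩ : ℂ) else 1

lemma gainMatrix_of_adj {u v : V} (h : Φ.graph.Adj u v) :
    Φ.gainMatrix u v = (Φ.gain ⟨(u, v), h⟩ : ℂ) := by simp [gainMatrix, h]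

lemma gainMatrix_of_not_adj {u v : V} (h : ¬ Φ.graph.Adj u v) : Φ.gainMatrix u v = 1 := by
  simp [gainMatrix, h]

lemma gain_swap {u v : V} (h : Φ.graph.Adj u v) :
    Φ.gain ⟨(v, u), h.symm⟩ = (Φ.gain ⟨(u, v), h⟩)⁻¹ :=
  Φ.gain_symm ⟨(u, v), h⟩

lemma isUnitWeight_gainMatrix : SimpleGraph.IsUnitWeight Φ.gainMatrix := by
  constructor
  · ext u v
    rw [Matrix.conjTranspose_apply]
    by_cases h : Φ.graph.Adj u v
    · rw [Φ.gainMatrix_of_adj h, Φ.gainMatrix_of_adj h.symm, Φ.gain_swap h,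
        Circle.coe_inv_eq_conj, Complex.star_def, Complex.conj_conj]
    · rw [Φ.gainMatrix_of_not_adj h, Φ.gainMatrix_of_not_adj fun h' => h h'.symm, star_one]
  · intro u v
    by_cases h : Φ.graph.Adj u v
    · rw [Φ.gainMatrix_of_adj h, Φ.gainMatrix_of_adj h.symm, Φ.gain_swap h, ← Circle.coe_mul,
        mul_inv_cancel, Circle.coe_one]
    · rw [Φ.gainMatrix_of_not_adj h, Φ.gainMatrix_of_not_adj fun h' => h h'.symm, one_mul]

lemma weightMatrix_gainMatrix : Φ.graph.weightMatrix Φ.gainMatrix = Φ.adjMatrix := by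
  ext u v
  by_cases h : Φ.graph.Adj u v
  · rw [SimpleGraph.weightMatrix_of_adj h, Φ.gainMatrix_of_adj h]
    simp [adjMatrix, h]
  · rw [SimpleGraph.weightMatrix_of_not_adj h]
    simp [adjMatrix, h]

lemma negInertia_eq [Fintype V] : Φ.negInertia = Φ.graph.negIndex Φ.gainMatrix := by
  classical
  rw [SimpleGraph.negIndex, Φ.weightMatrix_gainMatrix, Φ.isHermitian_adjMatrix.negIndex_eq]
  unfold negInertia
  convert rfl

/-- Every step of a walk is an edge, so the entries of `gainMatrix` off the edges never enter the
product. -/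
lemma walkGain_eq {u v : V} (p : Φ.graph.Walk u v) :
    Φ.walkGain p = SimpleGraph.seqGain Φ.gainMatrix p.getVert p.length := by
  induction p with
  | nil => simp [walkGain, SimpleGraph.seqGain]
  | cons h p ih =>
    rw [SimpleGraph.seqGain, SimpleGraph.Walk.length_cons, Finset.prod_range_succ']
    have h1 : Φ.walkGain (SimpleGraph.Walk.cons h p) = (Φ.gain ⟨(_, _), h⟩ : ℂ) * Φ.walkGain p := by
      simp [walkGain]
    rw [h1, ih, mul_comm, SimpleGraph.seqGain]
    congr 1
    simp [Φ.gainMatrix_of_adj h]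

lemma isTypeD_iff {u : V} (p : Φ.graph.Walk u u) :
    Φ.IsTypeD p ↔ SimpleGraph.IsTypeDSeq Φ.gainMatrix p.length p.getVert := by
  unfold IsTypeD SimpleGraph.IsTypeDSeq
  rw [Φ.walkGain_eq]

end UnitGainGraph

theorem theorem3p12 {V : Type*} [Fintype V] (Φ : UnitGainGraph V) (hconn : Φ.graph.Connected) :
    (Φ.negInertia : ℤ) = (Φ.graph.matchingNumber : ℤ) + Φ.graph.cyclomaticNumber ↔
      Φ.graph.DisjointCycles ∧
      (∀ (u : V) (p : Φ.graph.Walk u u), p.IsCycle → Φ.IsTypeD p) ∧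
      Φ.graph.contractCycles.matchingNumber =
        (Φ.graph.induce (Φ.graph.cycleVertsᶜ : Set V)).matchingNumber := by
  have hB := Φ.isUnitWeight_gainMatrix
  have hupper := SimpleGraph.negIndex_le_matchingNumber_add_cyclomaticNumber (B := Φ.gainMatrix)
    Φ.graph
  rw [Φ.negInertia_eq, SimpleGraph.disjointCycles_iff, SimpleGraph.matchingNumber_induce_compl]
  simp only [Φ.isTypeD_iff]
  constructor
  · intro h
    have hG := SimpleGraph.cyclesDisjoint_of_le_negIndex h.ge
    obtain ⟨hD, hm⟩ := SimpleGraph.allTypeD_and_matchingNumber_le hB Φ.graph hG h.ge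
    refine ⟨hG, hD, ?_⟩
    -- Together with `hm` this bounds the matching number of the contraction by that outside the
    -- cycles, the cycle part cancelling; `h2` is the converse inequality.
    have h1 := SimpleGraph.contractCycles_matchingNumber_add_le hG fun u p hp => (hD u p hp).1
    have h2 := Φ.graph.matchingNumber_isolate_cycleVerts_le
    omega
  · rintro ⟨hG, hD, hc⟩
    obtain ⟨K, π, hKO, hπO, hinj, hπ, hadj, hnbr, hcov⟩ :=
      SimpleGraph.exists_cover_of_contractCycles_matchingNumber_le hc.le
    exact le_antisymm hupper (SimpleGraph.le_negIndex_of_cover hB hG hD K π hKO hπO hinj hπ hadj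
      hnbr hcov)
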